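/- Let $S^2\subset\mathbb R^3$ be the round unit sphere with north pole $N=(0,0,1)$ and south pole $-N$. Let $J^1(S^2)=T^*S^2\times\mathbb R$ with contact form $dz-p\,dq$ and let $\Pi_L:J^1(S^2)\to T^*S^2$ be the Lagrangian projection. For $u\in\mathbb R^3$ and $q\in S^2$ write $\langle u,\cdot\rangle|_{T_qS^2}\in T_q^*S^2$ for the restricted linear form. *The knotted sphere.* For a unit vector $v\perp N$ let $\gamma_v(s)=-\cos(s)\,N+\sin(s)\,v$ be the geodesic that starts at the south pole with velocity $v$. Let $H:\mathbb R\to\mathbb R$ be a smooth function, even about $0$ and about $2\pi$, with $H'>0$ on $(0,2\pi)$ and $H''(2\pi)<H''(0)$. Let $$L_{knot}=\{(\gamma_v(s),\,H'(s)\langle\dot\gamma_v(s),\cdot\rangle|_{T_{\gamma_v(s)}S^2},\,H(s))\;:\;|v|=1,\ v\perp N,\ 0\le s\le 2\pi\}\subset J^1(S^2).$$ This is a Legendrian sphere with rotationally symmetric two-sheeted front: the sheets meet in a cone point over the north pole, and the only Reeb chord is a nondegenerate one of maximum type over the south pole. (For example $H(s)=-2\cos(s/2)$ has front $z=\pm|q-N|$.)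 *The standard sphere.* Let $$L_{std}=\{(q,\,-w\,\langle N,\cdot\rangle|_{T_qS^2},\,\tfrac23w^3)\;:\;q\in S^2,\ w\in\mathbb R,\ \langle q,N\rangle=-w^2\}\subset J^1(S^2),$$ the Legendrian sphere whose front is the flying saucer $z=\pm\frac23(-q_3)^{3/2}$ over the southern hemisphere, with one cusp edge over the equator and one Reeb chord over the south pole. **Proposition.** For every such $H$, the sets $\Pi_L(L_{knot})$ and $\Pi_L(L_{std})$ in $T^*S^2$ are smoothly ambient isotopic: there are diffeomorphisms $\Phi_t$ of $T^*S^2$, $t\in[0,1]$, depending smoothly on $(t,x)\in[0,1]\times T^*S^2$, with $\Phi_0=\mathrm{id}$ and $\Phi_1(\Pi_L(L_{knot}))=\Pi_L(L_{std})$. -/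

import Mathlib

open scoped Manifold ContDiff

noncomputable section

/-- Euclidean three-space. -/
abbrev E3 : Type := EuclideanSpace ℝ (Fin 3)

/-- The unit sphere `S² ⊂ ℝ³` with the smooth structure of Mathlib. -/
abbrev S2 : Type := Metric.sphere (0 : E3) 1

/-- The cotangent space `T*_q S²`. -/
abbrev CotangentSpaceS2 (q : S2) : Type := TangentSpace (𝓡 2) q →L[ℝ] ℝ

/-- The total space of the cotangent bundle `T*S²`; its topology and its smooth structure are the
ones Mathlib puts on bundles of continuous linear maps. -/
abbrev CotangentS2 : Type :=
  Bundle.TotalSpace (EuclideanSpace ℝ (Fin 2) →L[ℝ] ℝ) CotangentSpaceS2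

/-- The model with corners of the four-manifold `T*S²`. -/
abbrev cotangentModel :
    ModelWithCorners ℝ (EuclideanSpace ℝ (Fin 2) × (EuclideanSpace ℝ (Fin 2) →L[ℝ] ℝ))
      (ModelProd (EuclideanSpace ℝ (Fin 2)) (EuclideanSpace ℝ (Fin 2) →L[ℝ] ℝ)) :=
  (𝓡 2).prod 𝓘(ℝ, EuclideanSpace ℝ (Fin 2) →L[ℝ] ℝ)

/-- The 1-jet space `J¹(S²) = T*S² × ℝ`; the second coordinate is `z`, and the contact form is
`dz - p dq`, so that on a Legendrian surface `p` is the differential of `z`. -/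
abbrev JetS2 : Type := CotangentS2 × ℝ

/-- The Lagrangian projection `Π_L : J¹(S²) → T*S²`. -/
def lagrangianProjection (x : JetS2) : CotangentS2 := x.1

/-- The covector `⟨u, ·⟩` on `T_q S² ⊂ ℝ³`, that is, the restriction to the tangent plane at `q`
of the linear form on `ℝ³` given by `u`. -/
def covector (q : S2) (u : E3) : CotangentSpaceS2 q :=
  (innerSL ℝ u).comp (mfderiv (𝓡 2) 𝓘(ℝ, E3) (fun x : S2 => (x : E3)) q)

/-- The point of `J¹(S²)` over `q` with covector `⟨u, ·⟩` and height `z`. -/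
def jetPoint (q : S2) (u : E3) (z : ℝ) : JetS2 := (⟨q, covector q u⟩, z)

/-- The north pole `(0, 0, 1)`. -/
def northPole : E3 := EuclideanSpace.single 2 1

/-- The position at time `s` on the unit speed geodesic of the round sphere that starts at the
south pole with initial velocity `v` (a unit vector orthogonal to the axis). It is at the
north pole at time `π` and back at the south pole at time `2π`. -/
def geodesic (v : E3) (s : ℝ) : E3 := -(Real.cos s • northPole) + Real.sin s • v

/-- The velocity of `geodesic v` at time `s`. -/
def geodesicVelocity (v : E3) (s : ℝ) : E3 := Real.sin s • northPole + Real.cos s • v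

/-- Profiles of the rotationally symmetric front of the knotted sphere: `H s` is the
`z`-coordinate at time `s ∈ [0, 2π]` along each geodesic from the south pole, through the north
pole, back to the south pole.
The times in `[0, π]` give the lower sheet of the front, which is the graph of a function on `S²`
that is smooth away from the north pole, and the times in `[π, 2π]` give the upper sheet. The
two sheets meet in a cone point over the north pole. Evenness about `0` and `2π` is smoothness of
the two sheets over the south pole. Since `H' > 0` on `(0, 2π)`, the only vertical chord between
points with equal covectors is the one over the south pole; there the difference of the sheets is
maximal, and the last condition says that this maximum is nondegenerate. -/
structure IsKnottedProfile (H : ℝ → ℝ) : Prop where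
  smooth : ContDiff ℝ ∞ H
  even_zero : ∀ s : ℝ, H (-s) = H s
  even_two_pi : ∀ s : ℝ, H (2 * Real.pi + s) = H (2 * Real.pi - s)
  deriv_pos : ∀ s ∈ Set.Ioo 0 (2 * Real.pi), 0 < deriv H s
  nondegenerate : deriv (deriv H) (2 * Real.pi) < deriv (deriv H) 0

/-- The Legendrian sphere `L_knot ⊂ J¹(S²)` whose front has profile `H`. Over the point at time
`s` of a geodesic, the covector is `H' s` times the dual of the velocity (with respect to the
round metric). Over the north pole this is a whole circle of covectors, as for the front cone. -/
def knottedSphere (H : ℝ → ℝ) : Set JetS2 :=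
  {x | ∃ (v : E3) (s : ℝ) (q : S2), ‖v‖ = 1 ∧ inner ℝ v northPole = 0 ∧
    s ∈ Set.Icc 0 (2 * Real.pi) ∧ (q : E3) = geodesic v s ∧
    x = jetPoint q (deriv H s • geodesicVelocity v s) (H s)}

/-- The standard Legendrian sphere `L_std`, placed over the closed southern hemisphere (a disk).
Its front is the flying saucer `z = ± (2/3) (-q₃)^(3/2)`, `q₃ ≤ 0`, which has an upper and a lower
sheet, a semicubical cusp edge over the equator and one Reeb chord, over the south pole. The
parameter is `w = ± (-q₃)^(1/2)`; then `q₃ = -w²`, `z = (2/3) w³` and `dz = -w dq₃`. -/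
def standardSphere : Set JetS2 :=
  {x | ∃ (q : S2) (w : ℝ), inner ℝ (q : E3) northPole = -w ^ 2 ∧
    x = jetPoint q (-w • northPole) (2 / 3 * w ^ 3)}

/-- Two subsets `A`, `B` of a smooth manifold `M` are smoothly ambient isotopic: there is a family
of diffeomorphisms `Φ t` of `M`, smooth in `(t, x) ∈ [0, 1] × M`, with `Φ 0 = id` and
`Φ 1 (A) = B`. -/
def SmoothlyAmbientIsotopic {E : Type*} [NormedAddCommGroup E] [NormedSpace ℝ E] {H : Type*}
    [TopologicalSpace H] (I : ModelWithCorners ℝ E H) {M : Type*} [TopologicalSpace M]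
    [ChartedSpace H M] (A B : Set M) : Prop :=
  ∃ Φ : ℝ → (M ≃ₘ^∞⟮I, I⟯ M),
    ContMDiffOn (𝓘(ℝ, ℝ).prod I) I ∞ (fun y : ℝ × M => Φ y.1 y.2) (Set.Icc (0 : ℝ) 1 ×ˢ Set.univ) ∧
    (∀ x : M, Φ 0 x = x) ∧ Φ 1 '' A = B

end

/-!
The isotopy is explicit. Through the inner product, `T*S2` is the set of pairs `(q, p)` of vectors
with `|q| = 1` and `⟨q, p⟩ = 0`; `contMDiff_momentum` and `contMDiff_cotangentPoint` say that this
identification respects smoothness. A rotationally symmetric subset is described by four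
invariants: the height `a = ⟨q, N⟩`, the vertical component `b = ⟨p, N⟩`, the angular momentum
`μ = ⟨N, q × p⟩` and `e = |p|²`, subject to `e (1 - a²) = b² + μ²`. The points of the saucer and
of the cone surface below have `μ = 0`.

All profiles give the same surface up to a fibrewise affine map. The part of `H'` that is
antisymmetric under `s ↦ 2π - s` is `O(-cos s) sin s`, which adds the multiple `O(a)` of the
gradient of the height to `p`, and the symmetric part is `M(-cos s) sin (s / 2)` with `M > 0`,
which scales the fibres over the cone surface with profile derivative `sin (s / 2)`. Smoothness of
`M` and `O` at the poles comes from Hadamard's lemma and the description of zonal functions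
(`IsKnottedProfile.exists_decomposition`); positivity of `M` over the south pole is the
nondegeneracy of the Reeb chord.

The cone surface contains a circle of covectors over the north pole, while the saucer has a cusp
edge over the equator. They are exchanged by the map that rotates `q` about the axis `p` by the
angle `2 arctan |p|`: it takes the points over `N` with `|p| = 1` to points over the equator. In
detail, let `W = w²` for the parameter `w` of the saucer, so that `a = -W`, `e = W (1 - W²)`. The
translation by `N × q` gives `μ = 1 - W²` and `e = (1 + W) (1 - W²)`, and rotating `q` back about
the axis `p` gives points whose height `saucerHeight W` decreases from `1` to `-1` as `W` runs
over `[0, 1]`. So `W` is a smooth function of the new height, each height carries two values `±w`,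
and comparison of the invariants shows that the result is the image of the cone surface under
`p ↦ m p + g N × q` with `m` and `g` smooth functions of the height
(`isConePoint_iff_isSaucerPoint`). Affine maps of the fibres and the rotation about `p` both belong
to isotopies of `T*S2` (`isSmoothIsotopy_affine`, `isSmoothIsotopy_axisRotation`), and these are
composed.
-/

noncomputable section

/-! ### The cotangent bundle of the sphere as a set of pairs of vectors -/

lemma finrank_E3 : Fact (Module.finrank ℝ E3 = 2 + 1) := ⟨finrank_euclideanSpace_fin⟩

lemma contMDiff_coe_S2 : ContMDiff (𝓡 2) 𝓘(ℝ, E3) ∞ (fun x : S2 => (x : E3)) := by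
  have := finrank_E3
  exact contMDiff_coe_sphere

lemma contMDiff_codRestrict_S2 {E : Type*} [NormedAddCommGroup E] [NormedSpace ℝ E] {H : Type*}
    [TopologicalSpace H] {I : ModelWithCorners ℝ E H} {M : Type*} [TopologicalSpace M]
    [ChartedSpace H M] [IsManifold I ∞ M] {f : M → E3} (hf : ContMDiff I 𝓘(ℝ, E3) ∞ f)
    (hf' : ∀ x, f x ∈ Metric.sphere (0 : E3) 1) :
    ContMDiff I (𝓡 2) ∞ (fun x => (⟨f x, hf' x⟩ : S2)) := by
  have := finrank_E3
  exact hf.codRestrict_sphere hf'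

lemma ContDiff.comp_contMDiff_prodMk {F F' F'' : Type*} [NormedAddCommGroup F] [NormedSpace ℝ F]
    [NormedAddCommGroup F'] [NormedSpace ℝ F'] [NormedAddCommGroup F''] [NormedSpace ℝ F'']
    {E : Type*} [NormedAddCommGroup E] [NormedSpace ℝ E] {H : Type*}
    [TopologicalSpace H] {I : ModelWithCorners ℝ E H} {M : Type*} [TopologicalSpace M]
    [ChartedSpace H M] {n : ℕ∞ω} {g : F × F' → F''} {f : M → F} {f' : M → F'}
    (hg : ContDiff ℝ n g) (hf : ContMDiff I 𝓘(ℝ, F) n f) (hf' : ContMDiff I 𝓘(ℝ, F') n f') :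
    ContMDiff I 𝓘(ℝ, F'') n (fun x => g (f x, f' x)) :=
  hg.contMDiff.comp (hf.prodMk_space hf')

/-- The orthogonal projection of `u` to the plane orthogonal to `q` (for `q` a unit vector). -/
def tangentPart (q u : E3) : E3 := u - inner ℝ u q • q

/-- The sum of `q` and the tangent part of `u`, scaled to the unit sphere, for `q` a unit vector.
The norm of the sum is written as a square root of a function without zeros, so that the formula is
smooth on all of `E3 × E3`. -/
def sphereRetractAux (q u : E3) : E3 :=
  (√(1 + ‖tangentPart q u‖ ^ 2))⁻¹ • (q + tangentPart q u)

lemma sphereRetractAux_mem_sphere (q : S2) (u : E3) :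
    sphereRetractAux q u ∈ Metric.sphere (0 : E3) 1 := by
  have hq : ‖(q : E3)‖ = 1 := by simp
  have ho : inner ℝ (q : E3) (tangentPart q u) = 0 := by
    simp [tangentPart, inner_sub_right, inner_smul_right, real_inner_comm]
  have h2 : ‖(q : E3) + tangentPart q u‖ ^ 2 = 1 + ‖tangentPart q u‖ ^ 2 := by
    rw [@norm_add_sq_real, ho, hq]; ring
  have h3 : ‖(q : E3) + tangentPart q u‖ = √(1 + ‖tangentPart q u‖ ^ 2) := by
    rw [← h2, Real.sqrt_sq (norm_nonneg _)]
  have h4 : 0 < √(1 + ‖tangentPart q u‖ ^ 2) := by positivity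
  simp only [sphereRetractAux, mem_sphere_zero_iff_norm, norm_smul, norm_inv, h3, Real.norm_eq_abs,
    abs_of_pos h4]
  exact inv_mul_cancel₀ h4.ne'

/-- The map `E3 → S2` that moves `q` in the direction of the tangent part of its argument. It takes
`0` to `q`, and its differential at `0` is the orthogonal projection to the tangent plane. -/
def sphereRetract (q : S2) (u : E3) : S2 := ⟨sphereRetractAux q u, sphereRetractAux_mem_sphere q u⟩

lemma sphereRetract_zero (q : S2) : sphereRetract q 0 = q := by
  ext1; simp [sphereRetract, sphereRetractAux, tangentPart]

lemma contDiff_sphereRetractAux : ContDiff ℝ ∞ (fun y : E3 × E3 => sphereRetractAux y.1 y.2) := by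
  unfold sphereRetractAux tangentPart
  have h : ContDiff ℝ ∞ (fun y : E3 × E3 => y.2 - inner ℝ y.2 y.1 • y.1) :=
    contDiff_snd.sub ((contDiff_snd.inner ℝ contDiff_fst).smul contDiff_fst)
  have h1 : ContDiff ℝ ∞ (fun y : E3 × E3 => 1 + ‖y.2 - inner ℝ y.2 y.1 • y.1‖ ^ 2) :=
    contDiff_const.add (h.norm_sq ℝ)
  refine ContDiff.smul (ContDiff.inv (h1.sqrt fun y => ?_) fun y => ?_) (contDiff_fst.add h)
  · positivity
  · positivity

lemma contMDiff_sphereRetract :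
    ContMDiff ((𝓡 2).prod 𝓘(ℝ, E3)) (𝓡 2) ∞ (Function.uncurry sphereRetract) := by
  have h : ContMDiff ((𝓡 2).prod 𝓘(ℝ, E3)) 𝓘(ℝ, E3) ∞
      (fun y : S2 × E3 => sphereRetractAux (y.1 : E3) y.2) := by
    have h1 : ContMDiff ((𝓡 2).prod 𝓘(ℝ, E3)) 𝓘(ℝ, E3) ∞ (fun y : S2 × E3 => (y.1 : E3)) :=
      contMDiff_coe_S2.comp contMDiff_fst
    have h2 : ContMDiff ((𝓡 2).prod 𝓘(ℝ, E3)) 𝓘(ℝ, E3) ∞ (fun y : S2 × E3 => y.2) :=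
      contMDiff_snd
    exact contDiff_sphereRetractAux.comp_contMDiff_prodMk h1 h2
  exact contMDiff_codRestrict_S2 h fun y => sphereRetractAux_mem_sphere y.1 y.2

/-- The orthogonal projection `E3 → T_q S2`, obtained as a differential because the tangent space of
the sphere at `q` is not a subspace of `E3` but the model plane. -/
def tangentProjection (q : S2) : E3 →L[ℝ] TangentSpace (𝓡 2) q :=
  mfderiv 𝓘(ℝ, E3) (𝓡 2) (sphereRetract q) 0

/-- The orthogonal projections of a fixed vector form a smooth vector field on the sphere. -/
lemma contMDiff_tangentProjection (u : E3) :
    ContMDiff (𝓡 2) (𝓡 2).tangent ∞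
      (fun q : S2 => (⟨q, tangentProjection q u⟩ : TangentBundle (𝓡 2) S2)) := by
  intro q
  have h := ContMDiffAt.mfderiv (I := 𝓘(ℝ, E3)) (I' := 𝓡 2) (J := 𝓡 2) (x₀ := q) (m := ∞) (n := ∞)
    sphereRetract (fun _ => (0 : E3)) (contMDiff_sphereRetract _) contMDiffAt_const (by simp)
  simp only [sphereRetract_zero] at h
  have hv : ContMDiffAt (𝓡 2) 𝓘(ℝ, E3).tangent ∞
      (fun _ : S2 => (⟨0, u⟩ : TangentBundle 𝓘(ℝ, E3) E3)) q := contMDiffAt_const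
  exact ContMDiffAt.clm_apply_of_inCoordinates (b₁ := fun _ : S2 => (0 : E3))
    (b₂ := fun q : S2 => q)
    (E₁ := TangentSpace 𝓘(ℝ, E3)) (E₂ := TangentSpace (𝓡 2)) (ϕ := tangentProjection)
    (v := fun _ => u) h hv contMDiffAt_id

/-- The differential of the inclusion `S2 → E3`. -/
abbrev sphereInclusionDeriv (q : S2) : TangentSpace (𝓡 2) q →L[ℝ] E3 :=
  mfderiv (𝓡 2) 𝓘(ℝ, E3) (fun x : S2 => (x : E3)) q

lemma covector_apply (q : S2) (u : E3) (ξ : TangentSpace (𝓡 2) q) :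
    covector q u ξ = inner ℝ u (sphereInclusionDeriv q ξ) := rfl

lemma sphereInclusionDeriv_injective (q : S2) : Function.Injective (sphereInclusionDeriv q) := by
  have := finrank_E3
  exact injective_mvfderiv_subtypeVal_sphere q

lemma inner_sphereInclusionDeriv (q : S2) (ξ : TangentSpace (𝓡 2) q) :
    inner ℝ (q : E3) (sphereInclusionDeriv q ξ) = 0 := by
  have h : sphereInclusionDeriv q ξ ∈ (ℝ ∙ (q : E3))ᗮ := by
    have := finrank_E3
    rw [← range_mvfderiv_subtypeVal (n := 2)]
    exact ⟨ξ, rfl⟩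
  exact h _ (Submodule.mem_span_singleton_self _)

lemma hasFDerivAt_sphereRetractAux (q : E3) :
    HasFDerivAt (sphereRetractAux q)
      (ContinuousLinearMap.id ℝ E3 - (innerSL ℝ q).smulRight q) 0 := by
  have h1 : HasFDerivAt (tangentPart q)
      (ContinuousLinearMap.id ℝ E3 - (innerSL ℝ q).smulRight q) 0 := by
    have : tangentPart q =
        (ContinuousLinearMap.id ℝ E3 - (innerSL ℝ q).smulRight q : E3 →L[ℝ] E3) := by
      funext u
      change _ = u - inner ℝ q u • q
      rw [tangentPart, real_inner_comm]
    rw [this]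
    exact ContinuousLinearMap.hasFDerivAt _
  have h0 : tangentPart q 0 = 0 := by simp [tangentPart]
  have h2 : HasFDerivAt (fun u => 1 + ‖tangentPart q u‖ ^ 2) (0 : E3 →L[ℝ] ℝ) 0 := by
    have := (h1.norm_sq).const_add 1
    simpa [h0] using this
  have h3 : HasFDerivAt (fun u => (√(1 + ‖tangentPart q u‖ ^ 2))⁻¹) (0 : E3 →L[ℝ] ℝ) 0 := by
    have := (hasDerivAt_inv (x := √(1 + ‖tangentPart q 0‖ ^ 2)) (by simp [h0])).comp_hasFDerivAt 0
      (h2.sqrt (by simp [h0]))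
    refine (this.congr_fderiv ?_ :)
    simp
  have := h3.smul (h1.const_add q)
  refine (this.congr_fderiv ?_ : HasFDerivAt (sphereRetractAux q) _ 0)
  simp [h0]

lemma sphereInclusionDeriv_tangentProjection (q : S2) (u : E3) :
    sphereInclusionDeriv q (tangentProjection q u) = tangentPart q u := by
  have h1 : MDifferentiableAt 𝓘(ℝ, E3) (𝓡 2) (sphereRetract q) 0 := by
    have h : ContMDiff 𝓘(ℝ, E3) (𝓡 2) ∞ (fun u => Function.uncurry sphereRetract (q, u)) :=
      contMDiff_sphereRetract.comp (contMDiff_const.prodMk contMDiff_id)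
    exact (h 0).mdifferentiableAt (by simp)
  have h2 : MDifferentiableAt (𝓡 2) 𝓘(ℝ, E3) (fun x : S2 => (x : E3)) (sphereRetract q 0) :=
    (contMDiff_coe_S2 _).mdifferentiableAt (by simp)
  have h3 := mfderiv_comp (0 : E3) h2 h1
  have h4 : mfderiv 𝓘(ℝ, E3) 𝓘(ℝ, E3) ((fun x : S2 => (x : E3)) ∘ sphereRetract q) 0
      = ContinuousLinearMap.id ℝ E3 - (innerSL ℝ (q : E3)).smulRight (q : E3) := by
    rw [mfderiv_eq_fderiv]
    exact (hasFDerivAt_sphereRetractAux q).fderiv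
  rw [h4, sphereRetract_zero] at h3
  have h5 := DFunLike.congr_fun h3 u
  refine Eq.trans h5.symm ?_
  change u - inner ℝ (q : E3) u • (q : E3) = _
  rw [tangentPart, real_inner_comm]

lemma tangentProjection_sphereInclusionDeriv (q : S2) (ξ : TangentSpace (𝓡 2) q) :
    tangentProjection q (sphereInclusionDeriv q ξ) = ξ := by
  apply sphereInclusionDeriv_injective q
  rw [sphereInclusionDeriv_tangentProjection, tangentPart, real_inner_comm,
    inner_sphereInclusionDeriv, zero_smul, sub_zero]

/-- The tangent vector in `q^⊥ ⊂ E3` that represents a covector at `q` through the inner product.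
Together with the base point it identifies `T*S2` with `{(q, p) : |q| = 1, ⟨q, p⟩ = 0}`. -/
def momentum (x : CotangentS2) : E3 :=
  (InnerProductSpace.toDual ℝ E3).symm (x.2.comp (tangentProjection x.1))

lemma inner_momentum (x : CotangentS2) (u : E3) :
    inner ℝ (momentum x) u = x.2 (tangentProjection x.1 u) := by
  rw [momentum, InnerProductSpace.toDual_symm_apply]; rfl

/-- The point of `T*S2` over `q` with covector `⟨u, ·⟩`. -/
def cotangentPoint (q : S2) (u : E3) : CotangentS2 := ⟨q, covector q u⟩

lemma momentum_cotangentPoint (q : S2) (u : E3) :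
    momentum (cotangentPoint q u) = tangentPart q u := by
  refine ext_inner_right ℝ fun w => ?_
  rw [inner_momentum]
  change covector q u (tangentProjection q w) = _
  rw [covector_apply, sphereInclusionDeriv_tangentProjection]
  simp [tangentPart, inner_sub_left, inner_sub_right, inner_smul_left, inner_smul_right,
    real_inner_comm, mul_comm]

lemma cotangentPoint_momentum (x : CotangentS2) : cotangentPoint x.1 (momentum x) = x := by
  obtain ⟨q, p⟩ := x
  refine congrArg (Bundle.TotalSpace.mk q) ?_
  ext ξ
  rw [covector_apply, inner_momentum, tangentProjection_sphereInclusionDeriv]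

lemma inner_base_momentum (x : CotangentS2) : inner ℝ (x.1 : E3) (momentum x) = 0 := by
  rw [real_inner_comm, inner_momentum]
  have : tangentProjection x.1 (x.1 : E3) = 0 := by
    apply sphereInclusionDeriv_injective
    rw [sphereInclusionDeriv_tangentProjection, map_zero]
    simp [tangentPart]
  rw [this, map_zero]

lemma contMDiff_momentum : ContMDiff cotangentModel 𝓘(ℝ, E3) ∞ momentum := by
  have key : ∀ u : E3, ContMDiff cotangentModel 𝓘(ℝ, ℝ) ∞
      (fun x : CotangentS2 => inner ℝ (momentum x) u) := by
    intro u
    simp only [inner_momentum]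
    have hp : ContMDiff cotangentModel (𝓡 2) ∞ (fun x : CotangentS2 => x.1) :=
      Bundle.contMDiff_proj _
    have hv := (contMDiff_tangentProjection u).comp hp
    have hφ : ContMDiff cotangentModel cotangentModel ∞ (fun x : CotangentS2 => x) := contMDiff_id
    intro x
    have := ContMDiffAt.clm_bundle_apply (n := ∞) (IB := 𝓡 2) (IM := cotangentModel)
      (E₁ := TangentSpace (𝓡 2)) (F₁ := EuclideanSpace ℝ (Fin 2)) (F₂ := ℝ)
      (E₂ := Bundle.Trivial S2 ℝ) (b := fun x : CotangentS2 => x.1)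
      (ϕ := fun x : CotangentS2 => x.2) (v := fun x => tangentProjection x.1 u) (hφ x) (hv x)
    rw [Bundle.contMDiffAt_totalSpace] at this
    exact this.2
  -- smoothness of a map to `E3` can be tested on coordinates
  let b := EuclideanSpace.basisFun (Fin 3) ℝ
  have h : momentum = fun x => ∑ i, inner ℝ (momentum x) (b i) • b i := by
    funext x
    simp_rw [real_inner_comm (b _)]
    exact (b.sum_repr' (momentum x)).symm
  rw [h]
  exact contMDiff_finsetSum fun i _ => (key (b i)).smul contMDiff_const

/-- With `contMDiff_momentum` this allows the bundle `T*S2` to be replaced by pairs of vectors in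
`E3` in all questions of smoothness. -/
lemma contMDiff_cotangentPoint {E : Type*} [NormedAddCommGroup E] [NormedSpace ℝ E] {H : Type*}
    [TopologicalSpace H] {I : ModelWithCorners ℝ E H} {M : Type*} [TopologicalSpace M]
    [ChartedSpace H M] {f : M → S2} {u : M → E3} (hf : ContMDiff I (𝓡 2) ∞ f)
    (hu : ContMDiff I 𝓘(ℝ, E3) ∞ u) :
    ContMDiff I cotangentModel ∞ (fun x => cotangentPoint (f x) (u x)) := by
  intro x
  have key := contMDiffAt_hom_bundle (n := ∞) (IB := 𝓡 2) (IM := I)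
      (E₁ := TangentSpace (𝓡 2)) (F₁ := EuclideanSpace ℝ (Fin 2)) (F₂ := ℝ)
      (E₂ := Bundle.Trivial S2 ℝ) (fun x => cotangentPoint (f x) (u x)) (x₀ := x)
  refine key.2 ⟨hf x, ?_⟩
  have h1 := (contMDiff_coe_S2 (f x)).mfderiv_const (m := ∞) (by simp)
  have h2 := h1.comp x (hf x)
  have h3 : ContMDiffAt I 𝓘(ℝ, E3 →L[ℝ] ℝ) ∞ (fun x => innerSL ℝ (u x)) x :=
    (innerSL ℝ (E := E3)).contDiff.contMDiff.contMDiffAt.comp x (hu x)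
  refine (h3.clm_comp h2).congr_of_eventuallyEq (Filter.Eventually.of_forall fun y => ?_)
  ext ξ
  simp [inTangentCoordinates, ContinuousLinearMap.inCoordinates]
  rfl

/-! ### Division of smooth functions -/

/-- The weight `t ^ k` is there for the induction on `n`: differentiation under the integral sign
raises `k` by one. -/
lemma contDiff_nat_integral_segment (a : ℝ) (n : ℕ) : ∀ (k : ℕ) {f : ℝ → ℝ}, ContDiff ℝ ∞ f →
    ContDiff ℝ n (fun x => ∫ t in (0 : ℝ)..1, t ^ k * f (a + t * (x - a))) := by
  induction n with
  | zero =>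
    intro k f hf
    have hc := hf.continuous
    refine contDiff_zero.2
      (intervalIntegral.continuous_parametric_intervalIntegral_of_continuous' ?_ 0 1)
    simp only [Function.uncurry_def]
    fun_prop
  | succ n ih =>
    intro k f hf
    have hc := hf.continuous
    have hd : ContDiff ℝ ∞ (deriv f) := (contDiff_infty_iff_deriv.1 hf).2
    have hdc := hd.continuous
    have key : ∀ x, HasDerivAt (fun x => ∫ t in (0 : ℝ)..1, t ^ k * f (a + t * (x - a)))
        (∫ t in (0 : ℝ)..1, t ^ (k + 1) * deriv f (a + t * (x - a))) x := by
      intro x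
      obtain ⟨C, hC⟩ := ((isCompact_closedBall x 1).prod
        (isCompact_Icc (a := (0 : ℝ)) (b := 1))).exists_bound_of_continuousOn
        (f := fun y : ℝ × ℝ => y.2 ^ (k + 1) * deriv f (a + y.2 * (y.1 - a))) (by fun_prop)
      refine (intervalIntegral.hasDerivAt_integral_of_dominated_loc_of_deriv_le
        (F' := fun x t => t ^ (k + 1) * deriv f (a + t * (x - a))) (bound := fun _ => C)
        (Metric.closedBall_mem_nhds x one_pos) ?_ ?_ ?_ ?_ ?_ ?_).2
      · refine Filter.Eventually.of_forall fun y => Continuous.aestronglyMeasurable (by fun_prop)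
      · exact Continuous.intervalIntegrable (by fun_prop) _ _
      · exact Continuous.aestronglyMeasurable (by fun_prop)
      · refine Filter.Eventually.of_forall fun t ht y hy => hC (y, t) ⟨hy, ?_⟩
        rw [Set.uIoc_of_le zero_le_one] at ht
        exact ⟨ht.1.le, ht.2⟩
      · exact intervalIntegrable_const
      · refine Filter.Eventually.of_forall fun t ht y hy => ?_
        have h1 : HasDerivAt (fun y : ℝ => a + t * (y - a)) t y := by
          simpa using (((hasDerivAt_id y).sub_const a).const_mul t).const_add a
        have h2 := ((hf.differentiable (by simp)
          (a + t * (y - a))).hasDerivAt.comp y h1).const_mul (t ^ k)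
        refine h2.congr_deriv ?_
        ring
    rw [show ((n + 1 : ℕ) : ℕ∞ω) = (n : ℕ∞ω) + 1 by norm_cast, contDiff_succ_iff_deriv]
    refine ⟨fun x => (key x).differentiableAt, by simp, ?_⟩
    rw [show deriv _ = _ from funext fun x => (key x).deriv]
    exact ih (k + 1) hd

/-- Hadamard's lemma on the line. -/
lemma ContDiff.exists_eq_sub_mul {f : ℝ → ℝ} (hf : ContDiff ℝ ∞ f) {a : ℝ} (ha : f a = 0) :
    ∃ g : ℝ → ℝ, ContDiff ℝ ∞ g ∧ ∀ x, f x = (x - a) * g x := by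
  have hd : ContDiff ℝ ∞ (deriv f) := (contDiff_infty_iff_deriv.1 hf).2
  refine ⟨fun x => ∫ t in (0 : ℝ)..1, t ^ 0 * deriv f (a + t * (x - a)),
    contDiff_infty.2 fun n => contDiff_nat_integral_segment a n 0 hd, fun x => ?_⟩
  have hdc := hd.continuous
  have h : ∀ t ∈ Set.uIcc (0 : ℝ) 1, HasDerivAt (fun t => f (a + t * (x - a)))
      ((x - a) * (t ^ 0 * deriv f (a + t * (x - a)))) t := by
    intro t _
    have h1 : HasDerivAt (fun t : ℝ => a + t * (x - a)) (x - a) t := by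
      simpa using ((hasDerivAt_id t).mul_const (x - a)).const_add a
    refine ((hf.differentiable (by simp) (a + t * (x - a))).hasDerivAt.comp t h1).congr_deriv ?_
    ring
  have := intervalIntegral.integral_eq_sub_of_hasDerivAt h
    (Continuous.intervalIntegrable (by fun_prop) _ _)
  rw [intervalIntegral.integral_const_mul] at this
  rw [this]
  simp [ha]

/-- A smooth function that vanishes at the zeros of the sine is a smooth multiple of the sine. -/
lemma ContDiff.exists_eq_mul_sin {f : ℝ → ℝ} (hf : ContDiff ℝ ∞ f)
    (h0 : ∀ x, Real.sin x = 0 → f x = 0) :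
    ∃ g : ℝ → ℝ, ContDiff ℝ ∞ g ∧ ∀ x, f x = g x * Real.sin x := by
  classical
  refine ⟨fun x => if Real.sin x = 0 then deriv f x / Real.cos x else f x / Real.sin x, ?_, ?_⟩
  · refine contDiff_iff_contDiffAt.2 fun a => ?_
    by_cases ha : Real.sin a = 0
    · obtain ⟨f₁, hf₁, hf₁'⟩ := hf.exists_eq_sub_mul (h0 a ha)
      obtain ⟨s₁, hs₁, hs₁'⟩ := Real.contDiff_sin.exists_eq_sub_mul ha
      have hder : ∀ {φ φ₁ : ℝ → ℝ}, ContDiff ℝ ∞ φ₁ → (∀ x, φ x = (x - a) * φ₁ x) →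
          HasDerivAt φ (φ₁ a) a := by
        intro φ φ₁ hφ₁ h
        rw [show φ = fun x => (x - a) * φ₁ x from funext h]
        refine (((hasDerivAt_id a).sub_const a).mul
          (hφ₁.differentiable (by simp) a).hasDerivAt).congr_deriv ?_
        simp
      have hs : s₁ a = Real.cos a := (hder hs₁ hs₁').unique (Real.hasDerivAt_sin a)
      have hca : Real.cos a ≠ 0 := by
        intro h
        have := Real.sin_sq_add_cos_sq a
        simp [ha, h] at this
      refine ((hf₁.contDiffAt (x := a)).div hs₁.contDiffAt (by rwa [hs])).congr_of_eventuallyEq ?_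
      have hev : ∀ᶠ x in nhds a, s₁ x ≠ 0 :=
        hs₁.continuous.continuousAt.eventually_ne (by rwa [hs])
      filter_upwards [hev] with x hx
      by_cases hxa : x = a
      · subst hxa
        rw [if_pos ha, (hder hf₁ hf₁').deriv, ← hs]; rfl
      · have hxa' : x - a ≠ 0 := sub_ne_zero.2 hxa
        rw [if_neg (by rw [hs₁']; exact mul_ne_zero hxa' hx), hs₁', hf₁',
          mul_div_mul_left _ _ hxa']
        rfl
    · refine ((hf.contDiffAt (x := a)).div Real.contDiff_sin.contDiffAt ha).congr_of_eventuallyEq ?_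
      filter_upwards [Real.continuous_sin.continuousAt.eventually_ne ha] with x hx
      rw [if_neg hx]; rfl
  · intro x
    by_cases hx : Real.sin x = 0
    · simp [hx, h0 x hx]
    · simp only [if_neg hx]
      field_simp

lemma dense_sin_ne_zero : Dense {x : ℝ | Real.sin x ≠ 0} := by
  have : {x : ℝ | Real.sin x ≠ 0} = (Set.range fun n : ℤ => (n : ℝ) * Real.pi)ᶜ := by
    ext x
    simp [Real.sin_eq_zero_iff]
  rw [this]
  exact (Set.countable_range _).dense_compl ℝ

/-- Properties of a quotient by the sine can be checked after multiplication by the sine. -/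
lemma eq_of_mul_sin_eq {f g : ℝ → ℝ} (hf : Continuous f) (hg : Continuous g)
    (h : ∀ x, f x * Real.sin x = g x * Real.sin x) : f = g :=
  hf.ext_on dense_sin_ne_zero hg fun x hx => mul_right_cancel₀ hx (h x)

/-! ### Zonal functions and the derivative of a profile -/

/-- The smooth even `2π`-periodic functions: the functions of the angle that come from smooth
rotationally invariant functions on the sphere. -/
structure IsZonal (f : ℝ → ℝ) : Prop where
  smooth : ContDiff ℝ ∞ f
  even : Function.Even f
  periodic : Function.Periodic f (2 * Real.pi)

/-- A smooth odd `2π`-periodic function is the product of a zonal function and the sine. -/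
lemma exists_isZonal_mul_sin {f : ℝ → ℝ} (hf : ContDiff ℝ ∞ f) (ho : Function.Odd f)
    (hp : Function.Periodic f (2 * Real.pi)) :
    ∃ g, IsZonal g ∧ ∀ x, f x = g x * Real.sin x := by
  have h0 : ∀ x, Real.sin x = 0 → f x = 0 := by
    intro x hx
    obtain ⟨n, rfl⟩ := Real.sin_eq_zero_iff.1 hx
    -- the points `nπ` and `-nπ` differ by a period
    have h1 : f (-(n * Real.pi) + n * (2 * Real.pi)) = f (-(n * Real.pi)) := hp.int_mul n _
    rw [ho, show -(n * Real.pi) + n * (2 * Real.pi) = n * Real.pi by ring] at h1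
    linarith
  obtain ⟨g, hg, hfg⟩ := hf.exists_eq_mul_sin h0
  have hgc := hg.continuous
  refine ⟨g, ⟨hg, ?_, ?_⟩, hfg⟩
  · have : (fun x => g (-x)) = g := eq_of_mul_sin_eq (by fun_prop) hgc fun x => by
      rw [← hfg, ← neg_inj, ← ho, hfg, Real.sin_neg]; ring
    exact fun x => congrFun this x
  · have : (fun x => g (x + 2 * Real.pi)) = g := eq_of_mul_sin_eq (by fun_prop) hgc fun x => by
      rw [← hfg, ← hp, hfg, Real.sin_add_two_pi]
    exact fun x => congrFun this x

lemma IsZonal.exists_deriv_eq {f : ℝ → ℝ} (hf : IsZonal f) :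
    ∃ g, IsZonal g ∧ ∀ x, deriv f x = g x * Real.sin x := by
  refine exists_isZonal_mul_sin (contDiff_infty_iff_deriv.1 hf.smooth).2 (fun x => ?_) (fun x => ?_)
  · have h := deriv_comp_neg (f := f) (-x)
    rw [show (fun x => f (-x)) = f from funext hf.even, neg_neg] at h
    exact h
  · have h := deriv_comp_add_const f (2 * Real.pi) x
    rw [show (fun x => f (x + 2 * Real.pi)) = f from funext hf.periodic] at h
    exact h.symm

/-- A zonal function of the polar distance `s` is a smooth function of the height `-cos s`, up to
the end points. The derivative with respect to the height is `f' / sin`, which is zonal again, so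
the class of zonal functions carries an induction on the order of differentiability. -/
lemma IsZonal.contDiffOn_arccos {f : ℝ → ℝ} (hf : IsZonal f) :
    ContDiffOn ℝ ∞ (fun x => f (Real.arccos (-x))) (Set.Icc (-1) 1) := by
  refine contDiffOn_infty.2 fun n => ?_
  induction n generalizing f with
  | zero =>
    have := hf.smooth.continuous
    have h2 := Real.continuous_arccos
    exact contDiffOn_zero.2 (by fun_prop)
  | succ n ih =>
    obtain ⟨g, hg, hfg⟩ := hf.exists_deriv_eq
    have hfc := hf.smooth.continuous
    have hgc := hg.smooth.continuous
    have hac := Real.continuous_arccos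
    have hin : ∀ x ∈ Set.Ioo (-1 : ℝ) 1, HasDerivAt (fun x => f (Real.arccos (-x)))
        (g (Real.arccos (-x))) x := by
      intro x hx
      have h1 := (Real.hasDerivAt_arccos (x := -x) (by linarith [hx.2]) (by linarith [hx.1])).comp x
        (hasDerivAt_neg x)
      refine ((hf.smooth.differentiable (by simp) (Real.arccos (-x))).hasDerivAt.comp x
        h1).congr_deriv ?_
      have : 0 < √(1 - (-x) ^ 2) := Real.sqrt_pos.2 (by nlinarith [hx.1, hx.2])
      rw [hfg, Real.sin_arccos]
      generalize √(1 - (-x) ^ 2) = r at this ⊢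
      field_simp
    have hderiv : Set.EqOn (deriv fun x => f (Real.arccos (-x))) (fun x => g (Real.arccos (-x)))
        (Set.Ioo (-1) 1) := fun x hx => (hin x hx).deriv
    have hdiff : DifferentiableOn ℝ (fun x => f (Real.arccos (-x))) (Set.Ioo (-1) 1) :=
      fun x hx => (hin x hx).differentiableAt.differentiableWithinAt
    -- at the end points, where `arccos` is not differentiable, the one-sided derivative is the
    -- limit of the derivatives from inside
    have hcl : ∀ x ∈ Set.Icc (-1 : ℝ) 1, HasDerivWithinAt (fun x => f (Real.arccos (-x)))
        (g (Real.arccos (-x))) (Set.Icc (-1) 1) x := by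
      intro x hx
      have hct : Filter.Tendsto (fun x => g (Real.arccos (-x))) (nhds x)
        (nhds (g (Real.arccos (-x)))) := Continuous.tendsto (by fun_prop) x
      rcases hx.1.eq_or_lt with rfl | h1
      · refine (hasDerivWithinAt_Ici_of_tendsto_deriv hdiff
          (Continuous.continuousWithinAt (by fun_prop)) (Ioo_mem_nhdsGT (by norm_num)) ?_).mono
          Set.Icc_subset_Ici_self
        exact (hct.mono_left nhdsWithin_le_nhds).congr' (by
          filter_upwards [Ioo_mem_nhdsGT (show (-1 : ℝ) < 1 by norm_num)] with y hy
          exact (hderiv hy).symm)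
      rcases hx.2.eq_or_lt with rfl | h2
      · refine (hasDerivWithinAt_Iic_of_tendsto_deriv hdiff
          (Continuous.continuousWithinAt (by fun_prop)) (Ioo_mem_nhdsLT (by norm_num)) ?_).mono
          Set.Icc_subset_Iic_self
        exact (hct.mono_left nhdsWithin_le_nhds).congr' (by
          filter_upwards [Ioo_mem_nhdsLT (show (-1 : ℝ) < 1 by norm_num)] with y hy
          exact (hderiv hy).symm)
      exact (hin x ⟨h1, h2⟩).hasDerivWithinAt
    have hu : UniqueDiffOn ℝ (Set.Icc (-1 : ℝ) 1) := uniqueDiffOn_Icc (by norm_num)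
    rw [show ((n + 1 : ℕ) : ℕ∞ω) = (n : ℕ∞ω) + 1 by norm_cast, contDiffOn_succ_iff_derivWithin hu]
    refine ⟨fun x hx => (hcl x hx).differentiableWithinAt, by simp, ?_⟩
    exact (ih hg).congr fun x hx => (hcl x hx).derivWithin (hu x hx)

lemma IsZonal.apply_arccos_cos {f : ℝ → ℝ} (hf : IsZonal f) {s : ℝ}
    (hs : s ∈ Set.Icc 0 (2 * Real.pi)) : f (Real.arccos (Real.cos s)) = f s := by
  rcases le_total s Real.pi with h | h
  · rw [Real.arccos_cos hs.1 h]
  · rw [← Real.cos_two_pi_sub, Real.arccos_cos (by linarith [hs.2]) (by linarith), ← hf.even s,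
      ← hf.periodic (-s), neg_add_eq_sub]

lemma IsKnottedProfile.odd_deriv {H : ℝ → ℝ} (hH : IsKnottedProfile H) :
    Function.Odd (deriv H) := by
  intro s
  have h := deriv_comp_neg (f := H) s
  rw [show (fun x => H (-x)) = H from funext hH.even_zero] at h
  rw [h, neg_neg]

lemma IsKnottedProfile.deriv_two_pi_add {H : ℝ → ℝ} (hH : IsKnottedProfile H) (s : ℝ) :
    deriv H (2 * Real.pi + s) = -deriv H (2 * Real.pi - s) := by
  have h := deriv_comp_const_add (f := H) (2 * Real.pi) s
  rw [show (fun x => H (2 * Real.pi + x)) = fun x => H (2 * Real.pi - x) from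
    funext hH.even_two_pi, deriv_comp_const_sub] at h
  exact h.symm

/-- The points over a given height `-cos s` occur at the times `s` and `2π - s`. The part of `H'`
that is symmetric under `s ↦ 2π - s` is `M(-cos s) sin (s / 2)`, and the antisymmetric part is
`O(-cos s) sin s`, with `M` and `O` smooth up to the poles. -/
lemma IsKnottedProfile.exists_decomposition {H : ℝ → ℝ} (hH : IsKnottedProfile H) :
    ∃ M O : ℝ → ℝ, ContDiffOn ℝ ∞ M (Set.Icc (-1) 1) ∧ ContDiffOn ℝ ∞ O (Set.Icc (-1) 1) ∧
      (∀ x ∈ Set.Icc (-1 : ℝ) 1, 0 < M x) ∧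
      ∀ s ∈ Set.Icc 0 (2 * Real.pi),
        deriv H s = M (-Real.cos s) * Real.sin (s / 2) + O (-Real.cos s) * Real.sin s := by
  have hs : ContDiff ℝ ∞ (deriv H) := (contDiff_infty_iff_deriv.1 hH.smooth).2
  have hodd := hH.odd_deriv
  have hsub : ∀ s, deriv H (s + 2 * Real.pi) = -deriv H (2 * Real.pi - s) := fun s => by
    rw [add_comm, hH.deriv_two_pi_add]
  have hper : ∀ s, deriv H (s + 2 * Real.pi + 2 * Real.pi) = deriv H s := fun s => by
    rw [hsub, show 2 * Real.pi - (s + 2 * Real.pi) = -s by ring, hodd, neg_neg]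
  -- `H'` is odd of period `4π`; averaging with its translate by `2π` gives a function of period
  -- `2π`
  obtain ⟨o, ho, ho'⟩ := exists_isZonal_mul_sin
    (f := fun s => (deriv H s + deriv H (s + 2 * Real.pi)) / 2) (by fun_prop)
    (fun s => by
      simp only [hsub, hodd s, show 2 * Real.pi - -s = s + 2 * Real.pi by ring]; ring)
    (fun s => by simp only [hper]; ring)
  -- the other part changes sign under translation by `2π`, so it has period `2π` in `x = s / 2`
  obtain ⟨g, hg, hg'⟩ := exists_isZonal_mul_sin
    (f := fun x => (deriv H (2 * x) - deriv H (2 * x + 2 * Real.pi)) / 2) (by fun_prop)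
    (fun x => by
      simp only [mul_neg, hsub (-(2 * x)), hodd (2 * x),
        show 2 * Real.pi - -(2 * x) = 2 * x + 2 * Real.pi by ring]; ring)
    (fun x => by simp only [mul_add, two_mul (2 * Real.pi), ← add_assoc, hper])
  have hgπ : (fun x => g (x + Real.pi)) = g := by
    have hgc := hg.smooth.continuous
    refine eq_of_mul_sin_eq (by fun_prop) hgc fun x => ?_
    have h1 := hg' (x + Real.pi)
    simp only [mul_add, hper, Real.sin_add_pi] at h1
    rw [← hg']
    linarith
  have hm : IsZonal (fun s => g (s / 2)) := by
    have hgs := hg.smooth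
    refine ⟨by fun_prop, fun s => ?_, fun s => ?_⟩
    · simp only [neg_div, hg.even (s / 2)]
    · simp only [add_div, mul_div_cancel_left₀ Real.pi (two_ne_zero' ℝ)]
      exact congrFun hgπ (s / 2)
  refine ⟨_, _, hm.contDiffOn_arccos, ho.contDiffOn_arccos, fun x hx => ?_, fun s hs => ?_⟩
  · rcases (Real.arccos_nonneg (-x)).eq_or_lt with h0 | h0
    · -- over the south pole positivity is the nondegeneracy of the chord
      rw [← h0, zero_div]
      have hd : Differentiable ℝ (deriv H) := hs.differentiable (by simp)
      have h1 : HasDerivAt (fun x => (deriv H (2 * x) - deriv H (2 * x + 2 * Real.pi)) / 2)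
          (deriv (deriv H) 0 - deriv (deriv H) (2 * Real.pi)) 0 := by
        have e1 : HasDerivAt (fun x : ℝ => 2 * x) 2 0 := by
          simpa using (hasDerivAt_id (0 : ℝ)).const_mul 2
        have e2 : HasDerivAt (fun x : ℝ => 2 * x + 2 * Real.pi) 2 0 := e1.add_const _
        have e3 := (hd (2 * 0)).hasDerivAt.comp 0 e1
        have e4 := (hd (2 * 0 + 2 * Real.pi)).hasDerivAt.comp 0 e2
        refine ((e3.sub e4).div_const 2).congr_deriv ?_
        simp only [mul_zero, zero_add]
        ring
      have h2 : HasDerivAt (fun x => g x * Real.sin x) (g 0) 0 := by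
        refine ((hg.smooth.differentiable (by simp) 0).hasDerivAt.mul
          (Real.hasDerivAt_sin 0)).congr_deriv ?_
        simp
      rw [show (fun x => (deriv H (2 * x) - deriv H (2 * x + 2 * Real.pi)) / 2) =
        fun x => g x * Real.sin x from funext hg'] at h1
      rw [← h1.unique h2]
      linarith [hH.nondegenerate]
    · have h1 := hg' (Real.arccos (-x) / 2)
      have h2 := Real.arccos_le_pi (-x)
      have h3 := Real.pi_pos
      rw [mul_div_cancel₀ _ (two_ne_zero' ℝ), hsub] at h1
      have h4 : 0 < Real.sin (Real.arccos (-x) / 2) :=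
        Real.sin_pos_of_pos_of_lt_pi (by linarith) (by linarith)
      have h5 := hH.deriv_pos (Real.arccos (-x)) ⟨h0, by linarith⟩
      have h6 := hH.deriv_pos (2 * Real.pi - Real.arccos (-x)) ⟨by linarith, by linarith⟩
      refine pos_of_mul_pos_left (b := Real.sin (Real.arccos (-x) / 2)) ?_ h4.le
      rw [← h1]
      linarith
  · have h1 := hg' (s / 2)
    rw [mul_div_cancel₀ _ (two_ne_zero' ℝ)] at h1
    rw [neg_neg, hm.apply_arccos_cos hs, ho.apply_arccos_cos hs, ← h1, ← ho']
    ring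

/-! ### The cross product and rotation invariants -/

/-- The cross product of `E3`. -/
def cross (u v : E3) : E3 := WithLp.toLp 2 (crossProduct u.ofLp v.ofLp)

lemma contDiff_cross : ContDiff ℝ ∞ (fun y : E3 × E3 => cross y.1 y.2) := by
  refine contDiff_euclidean.2 fun i => ?_
  have h : ∀ j, ContDiff ℝ ∞ (fun y : E3 × E3 => y.1 j) := fun j => by fun_prop
  have h' : ∀ j, ContDiff ℝ ∞ (fun y : E3 × E3 => y.2 j) := fun j => by fun_prop
  fin_cases i <;> simp [cross, cross_apply] <;> fun_prop

lemma inner_eq_sum (u v : E3) : inner ℝ u v = u 0 * v 0 + u 1 * v 1 + u 2 * v 2 := by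
  simp [PiLp.inner_apply, Fin.sum_univ_three, mul_comm]

lemma inner_cross_self_left (u v : E3) : inner ℝ u (cross u v) = 0 := by
  simp only [inner_eq_sum]
  simp [cross, cross_apply]
  ring

lemma inner_cross_self_right (u v : E3) : inner ℝ v (cross u v) = 0 := by
  simp only [inner_eq_sum]
  simp [cross, cross_apply]
  ring

/-- The cyclic symmetry of the triple product. -/
lemma inner_cross_cycle (u v w : E3) : inner ℝ u (cross v w) = inner ℝ w (cross u v) := by
  simp only [inner_eq_sum]
  simp [cross, cross_apply]
  ring

/-- Lagrange's identity. -/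
lemma inner_cross_cross_self (u v : E3) :
    inner ℝ (cross u v) (cross u v)
      = inner ℝ u u * inner ℝ v v - inner ℝ u v ^ 2 := by
  simp only [inner_eq_sum]
  simp [cross, cross_apply]
  ring

lemma cross_add_left (u v w : E3) : cross (u + v) w = cross u w + cross v w := by
  simp [cross]

lemma cross_add_right (u v w : E3) : cross u (v + w) = cross u v + cross u w := by
  simp [cross]

lemma cross_smul_left (c : ℝ) (u v : E3) : cross (c • u) v = c • cross u v := by
  simp [cross]

lemma cross_smul_right (c : ℝ) (u v : E3) : cross u (c • v) = c • cross u v := by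
  simp [cross]

lemma cross_cross_self_right (u v : E3) :
    cross (cross u v) v = inner ℝ u v • v - inner ℝ v v • u := by
  simp only [inner_eq_sum]
  ext i; fin_cases i <;> simp [cross, cross_apply] <;> ring

lemma norm_northPole : ‖northPole‖ = 1 := by simp [northPole]

lemma inner_northPole_self : inner ℝ northPole northPole = 1 := by
  rw [real_inner_self_eq_norm_sq, norm_northPole, one_pow]

lemma inner_coe_S2_self (q : S2) : inner ℝ (q : E3) (q : E3) = 1 := by
  rw [real_inner_self_eq_norm_sq]; simp

/-- The relation between the invariants of a tangent vector `p` at `q` under rotation about the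
axis: height of `q`, vertical component of `p`, angular momentum and length of `p`. -/
lemma normSq_mul_one_sub_height_sq {q p : E3} (hq : inner ℝ q q = 1) (hp : inner ℝ q p = 0) :
    inner ℝ p p * (1 - inner ℝ q northPole ^ 2)
      = inner ℝ p northPole ^ 2 + inner ℝ northPole (cross q p) ^ 2 := by
  simp only [inner_eq_sum, northPole, cross, cross_apply] at *
  simp at *
  linear_combination
    (p 2 ^ 2 - (p 0 * p 0 + p 1 * p 1 + p 2 * p 2)) * hq + (q 0 * p 0 + q 1 * p 1 - q 2 * p 2) * hp

/-! ### The cone surface -/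

/-- The pairs `(q, p)` of the rotationally symmetric two-sheeted surface with profile derivative
`sin (s / 2)`, described by rotation invariants; the parameter is `y = cos (s / 2)`. The angular
momentum vanishes as a consequence, by `normSq_mul_one_sub_height_sq`. -/
def IsConePoint (q p : E3) : Prop :=
  ∃ y ∈ Set.Icc (-1 : ℝ) 1, inner ℝ q northPole = 1 - 2 * y ^ 2 ∧
    inner ℝ p northPole = 2 * y * (1 - y ^ 2) ∧ inner ℝ p p = 1 - y ^ 2

lemma isConePoint_iff {q p : E3} (hq : inner ℝ q q = 1) (hp : inner ℝ q p = 0) :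
    IsConePoint q p ↔ ∃ (v : E3) (s : ℝ), ‖v‖ = 1 ∧ inner ℝ v northPole = 0 ∧
      s ∈ Set.Icc 0 (2 * Real.pi) ∧ q = geodesic v s ∧
      p = Real.sin (s / 2) • geodesicVelocity v s := by
  constructor
  · rintro ⟨y, hy, h1, h2, h3⟩
    have hqN := real_inner_comm q northPole
    have hpN := real_inner_comm p northPole
    have hpq := real_inner_comm p q
    -- over the south pole `p = 0`, and every direction `v` does
    by_cases hy1 : 1 - y ^ 2 = 0
    · refine ⟨EuclideanSpace.single 0 1, 0, by simp,
        by simp [northPole, EuclideanSpace.inner_single_left],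
        ⟨le_rfl, by positivity⟩, ?_, ?_⟩
      · have : inner ℝ (q + northPole) (q + northPole) = 0 := by
          simp only [inner_add_left, inner_add_right, hq, inner_northPole_self]
          linarith
        rw [inner_self_eq_zero] at this
        simp [geodesic, eq_neg_of_add_eq_zero_left this]
      · rw [hy1, inner_self_eq_zero] at h3
        simp [h3]
    · have hr2 : 0 < 1 - y ^ 2 := lt_of_le_of_ne (by nlinarith [hy.1, hy.2]) (Ne.symm hy1)
      obtain ⟨r, hr, hrr⟩ : ∃ r : ℝ, 0 < r ∧ r ^ 2 = 1 - y ^ 2 :=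
        ⟨√(1 - y ^ 2), Real.sqrt_pos.2 hr2, Real.sq_sqrt hr2.le⟩
      have hc : Real.cos (Real.arccos y) = y := Real.cos_arccos hy.1 hy.2
      have hs : Real.sin (Real.arccos y) = r := by
        rw [Real.sin_arccos, ← hrr, Real.sqrt_sq hr.le]
      obtain ⟨p', hp'⟩ : ∃ p', p = r • p' :=
        ⟨r⁻¹ • p, by rw [smul_smul, mul_inv_cancel₀ hr.ne', one_smul]⟩
      subst hp'
      have e1 : inner ℝ p' p' = 1 := by
        simp only [real_inner_smul_left, real_inner_smul_right, ← hrr] at h3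
        have : r ^ 2 * (inner ℝ p' p' - 1) = 0 := by linear_combination h3
        rcases mul_eq_zero.1 this with h | h
        · exact absurd h (by positivity)
        · linarith
      have e2 : inner ℝ q p' = 0 := by
        simpa [inner_smul_right, hr.ne'] using hp
      have e3 : inner ℝ p' northPole = 2 * y * r := by
        simp only [real_inner_smul_left, ← hrr] at h2
        have : r * (inner ℝ p' northPole - 2 * y * r) = 0 := by linear_combination h2
        rcases mul_eq_zero.1 this with h | h
        · exact absurd h (by positivity)
        · linarith
      have hp'q : inner ℝ p' q = 0 := by rw [real_inner_comm, e2]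
      have hNq : inner ℝ northPole q = 1 - 2 * y ^ 2 := by rw [real_inner_comm, h1]
      have hNp' : inner ℝ northPole p' = 2 * y * r := by rw [real_inner_comm, e3]
      -- `q` and `p' = p / sin (s / 2)` are orthonormal, and the projection of `N` to their plane
      -- has length one
      have hN : northPole = (1 - 2 * y ^ 2) • q + (2 * y * r) • p' := by
        have : inner ℝ (northPole - ((1 - 2 * y ^ 2) • q + (2 * y * r) • p'))
            (northPole - ((1 - 2 * y ^ 2) • q + (2 * y * r) • p')) = 0 := by
          simp only [inner_add_left, inner_add_right, inner_sub_left, inner_sub_right,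
            real_inner_smul_left, real_inner_smul_right, inner_northPole_self, hq, e1, e2,
            e3, h1, hNq, hNp', hp'q]
          linear_combination (- 4 * y ^ 2) * hrr
        exact sub_eq_zero.1 (inner_self_eq_zero.1 this)
      refine ⟨(2 * y * r) • q - (1 - 2 * y ^ 2) • p', 2 * Real.arccos y, ?_, ?_,
        ⟨by linarith [Real.arccos_nonneg y], by linarith [Real.arccos_le_pi y]⟩, ?_, ?_⟩
      · refine (sq_eq_sq₀ (norm_nonneg _) zero_le_one).1 ?_
        rw [← real_inner_self_eq_norm_sq]
        simp only [inner_sub_left, inner_sub_right, real_inner_smul_left, real_inner_smul_right,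
          hq, e1, e2, hp'q]
        linear_combination (4 * y ^ 2) * hrr
      · simp only [inner_sub_left, real_inner_smul_left, h1, e3]
        ring
      · rw [geodesic, Real.cos_two_mul, Real.sin_two_mul, hc, hs]
        nth_rw 1 [hN]
        match_scalars <;> grind
      · rw [geodesicVelocity, mul_div_cancel_left₀ _ (two_ne_zero' ℝ), Real.cos_two_mul,
          Real.sin_two_mul, hc, hs]
        nth_rw 1 [hN]
        match_scalars <;> grind
  · rintro ⟨v, s, hv, hvN, hs, rfl, rfl⟩
    have hc : Real.cos s = 2 * Real.cos (s / 2) ^ 2 - 1 := by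
      rw [← Real.cos_two_mul]; ring_nf
    have hs : Real.sin s = 2 * Real.sin (s / 2) * Real.cos (s / 2) := by
      rw [← Real.sin_two_mul]; ring_nf
    have hsc := Real.sin_sq_add_cos_sq (s / 2)
    have hsc' := Real.sin_sq_add_cos_sq s
    have hvv : inner ℝ v v = 1 := by rw [real_inner_self_eq_norm_sq, hv, one_pow]
    have hNv : inner ℝ northPole v = 0 := by rw [real_inner_comm, hvN]
    refine ⟨Real.cos (s / 2), ⟨Real.neg_one_le_cos _, Real.cos_le_one _⟩, ?_, ?_, ?_⟩
    · simp only [geodesic, inner_add_left, real_inner_smul_left, inner_northPole_self, hvN,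
        inner_neg_left]
      linear_combination -hc
    · simp only [geodesicVelocity, inner_add_left, real_inner_smul_left, inner_northPole_self, hvN]
      rw [hs]
      linear_combination (2 * Real.cos (s / 2)) * hsc
    · simp only [geodesicVelocity, inner_add_left, inner_add_right, real_inner_smul_left,
        real_inner_smul_right, inner_northPole_self, hvN, hNv, hvv]
      linear_combination (Real.sin (s / 2) ^ 2) * hsc' + hsc

/-! ### Smooth inverses on compact intervals -/

/-- A smooth function with negative derivative on a compact interval has an inverse that is smooth
up to the end points. -/
lemma exists_contDiffOn_inverse_Icc {f : ℝ → ℝ} {a b : ℝ} (hab : a ≤ b)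
    (hf : ∀ x ∈ Set.Icc a b, ContDiffAt ℝ ∞ f x) (hf' : ∀ x ∈ Set.Icc a b, deriv f x < 0) :
    Set.BijOn f (Set.Icc a b) (Set.Icc (f b) (f a)) ∧
    ∃ g : ℝ → ℝ, ContDiffOn ℝ ∞ g (Set.Icc (f b) (f a)) ∧
      Set.MapsTo g (Set.Icc (f b) (f a)) (Set.Icc a b) ∧
      Set.InvOn g f (Set.Icc a b) (Set.Icc (f b) (f a)) := by
  have hc : ContinuousOn f (Set.Icc a b) := fun x hx => (hf x hx).continuousAt.continuousWithinAt
  have hanti : StrictAntiOn f (Set.Icc a b) :=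
    strictAntiOn_of_deriv_neg (convex_Icc a b) hc fun x hx => hf' x (interior_subset hx)
  have hle : f b ≤ f a := hanti.antitoneOn (Set.left_mem_Icc.2 hab) (Set.right_mem_Icc.2 hab) hab
  have hbij : Set.BijOn f (Set.Icc a b) (Set.Icc (f b) (f a)) :=
    ⟨fun x hx => ⟨hanti.antitoneOn hx (Set.right_mem_Icc.2 hab) hx.2,
      hanti.antitoneOn (Set.left_mem_Icc.2 hab) hx hx.1⟩, hanti.injOn,
      intermediate_value_Icc' hab hc⟩
  refine ⟨hbij, ?_⟩
  let E := Set.BijOn.equiv f hbij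
  have hE : Continuous E := (hc.domRestrict).subtype_mk _
  let h := hE.homeoOfEquivCompactToT2
  -- the inverse is extended by constants to a continuous function on the line; near each point of
  -- the closed interval it agrees within the interval with a local inverse of `f`
  let g : ℝ → ℝ := fun y => (h.symm (Set.projIcc (f b) (f a) hle y) : ℝ)
  have hgc : Continuous g := continuous_subtype_val.comp (h.symm.continuous.comp continuous_projIcc)
  have hgm : ∀ y, g y ∈ Set.Icc a b := fun y => (h.symm _).2
  have hfg : ∀ y ∈ Set.Icc (f b) (f a), f (g y) = y := by
    intro y hy
    have : (h (h.symm (Set.projIcc (f b) (f a) hle y)) : ℝ) = y := by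
      rw [h.apply_symm_apply, Set.projIcc_of_mem hle hy]
    exact this
  refine ⟨g, fun y hy => ?_, fun y _ => hgm y, fun x hx => ?_, hfg⟩
  · have hx := hgm y
    have hd : HasDerivAt f (deriv f (g y)) (g y) :=
      ((hf _ hx).differentiableAt (by simp)).hasDerivAt
    have hd' := hd.hasFDerivAt_equiv (hf' _ hx).ne
    have hs := (hf _ hx).hasStrictFDerivAt' hd' (by simp)
    have h1 := (hf _ hx).to_localInverse hd' (by simp)
    rw [hfg y hy] at h1
    have h2 := (hs.eventually_left_inverse).filter_mono (hgc.tendsto y)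
    refine h1.contDiffWithinAt.congr_of_eventuallyEq ?_ ?_
    · have h3 := (hgc.tendsto y).eventually hs.eventually_left_inverse
      filter_upwards [nhdsWithin_le_nhds h3, self_mem_nhdsWithin] with z hz hz'
      rw [hfg z hz'] at hz
      exact hz.symm
    · have h3 := hs.eventually_left_inverse.self_of_nhds
      rw [hfg y hy] at h3
      exact h3.symm
  · exact hanti.injOn (hgm _) hx (hfg _ (hbij.mapsTo hx))

/-! ### The heights and scales of the rotated saucer -/

/-- The number `1 + |p|²` at the points of parameter `W = w²` of the saucer translated by `N × q`;
there `|p|² = (1 + W) (1 - W²)`. -/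
def saucerDenom (W : ℝ) : ℝ := 2 + W - W ^ 2 - W ^ 3

/-- The height of `q` at the points of parameter `W = w²` of the translated saucer, after `q` has
been rotated about the axis `p` by the angle `-2 arctan |p|`. -/
def saucerHeight (W : ℝ) : ℝ := (2 - W ^ 2 - W ^ 3 - W ^ 4) / saucerDenom W

/-- The polynomial factor in `1 + saucerHeight W = (1 - W) * saucerPoly W / saucerDenom W`. -/
def saucerPoly (W : ℝ) : ℝ := W ^ 3 + 3 * W ^ 2 + 5 * W + 4

/-- The ratio `λ` in the change of parameter `y = -λ w` between the cone surface and the saucer,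
which equates the heights: `saucerHeight W = 1 - 2 y²`. -/
def saucerRatio (W : ℝ) : ℝ := √((1 + W ^ 3) / (2 * saucerDenom W))

/-- The factor by which `p` at the corresponding point of the cone surface has to be scaled, found
by comparison of the vertical components. -/
def saucerScale (W : ℝ) : ℝ := (1 + W) * saucerDenom W / (saucerPoly W * saucerRatio W)

/-- The multiple of `N × q` that has to be added to `p`: the angular momentum divided by
`1 - saucerHeight W ^ 2`. The common factor `W * (1 - W)` is cancelled, so that the
formula is smooth on `[0, 1]`. -/
def saucerTwist (W : ℝ) : ℝ :=
  (1 + W) * (1 + 3 * W + W ^ 2) * saucerDenom W / ((1 + W ^ 3) * saucerPoly W)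

lemma saucerDenom_pos {W : ℝ} (hW : W ∈ Set.Icc (0 : ℝ) 1) : 0 < saucerDenom W := by
  have h : 0 ≤ W * (1 - W ^ 2) := mul_nonneg hW.1 (by nlinarith [hW.1, hW.2])
  unfold saucerDenom
  nlinarith [hW.1, hW.2]

lemma saucerPoly_pos {W : ℝ} (hW : W ∈ Set.Icc (0 : ℝ) 1) : 0 < saucerPoly W := by
  have := hW.1
  unfold saucerPoly
  positivity

lemma one_add_cube_pos {W : ℝ} (hW : W ∈ Set.Icc (0 : ℝ) 1) : 0 < 1 + W ^ 3 := by
  have := hW.1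
  positivity

lemma saucerRatio_pos {W : ℝ} (hW : W ∈ Set.Icc (0 : ℝ) 1) : 0 < saucerRatio W :=
  Real.sqrt_pos.2 (div_pos (one_add_cube_pos hW) (mul_pos two_pos (saucerDenom_pos hW)))

lemma saucerRatio_sq {W : ℝ} (hW : W ∈ Set.Icc (0 : ℝ) 1) :
    saucerRatio W ^ 2 = (1 + W ^ 3) / (2 * saucerDenom W) :=
  Real.sq_sqrt (div_pos (one_add_cube_pos hW) (mul_pos two_pos (saucerDenom_pos hW))).le

lemma saucerScale_pos {W : ℝ} (hW : W ∈ Set.Icc (0 : ℝ) 1) : 0 < saucerScale W := by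
  have := hW.1
  have h1 := saucerDenom_pos hW
  have h2 := saucerPoly_pos hW
  have h3 := saucerRatio_pos hW
  unfold saucerScale
  positivity

lemma saucerHeight_eq {W : ℝ} (hW : W ∈ Set.Icc (0 : ℝ) 1) :
    saucerHeight W = 1 - 2 * (saucerRatio W ^ 2 * W) := by
  have h1 := saucerDenom_pos hW
  rw [saucerRatio_sq hW, saucerHeight]
  field_simp
  unfold saucerDenom
  ring

/-- The vertical components of `p` agree (the common factor `-w` is cancelled). -/
lemma saucerScale_mul {W : ℝ} (hW : W ∈ Set.Icc (0 : ℝ) 1) :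
    saucerScale W * (2 * saucerRatio W * (1 - saucerRatio W ^ 2 * W)) = 1 - W ^ 2 := by
  have h1 := (saucerDenom_pos hW).ne'
  have h2 := (saucerPoly_pos hW).ne'
  have h3 := (saucerRatio_pos hW).ne'
  rw [saucerRatio_sq hW, saucerScale]
  field_simp
  unfold saucerDenom saucerPoly
  ring

/-- The lengths of `p` agree: the rotation about `p` preserves the value `(1 + W) (1 - W²)` of
`|p|²` at the translated saucer. -/
lemma saucerScale_sq_add {W : ℝ} (hW : W ∈ Set.Icc (0 : ℝ) 1) :
    saucerScale W ^ 2 * (1 - saucerRatio W ^ 2 * W)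
      + saucerTwist W ^ 2 * (1 - saucerHeight W ^ 2) = (1 + W) * (1 - W ^ 2) := by
  have h1 := (saucerDenom_pos hW).ne'
  have h2 := (saucerPoly_pos hW).ne'
  have h4 := (one_add_cube_pos hW).ne'
  rw [saucerScale, div_pow, mul_pow (saucerPoly W), saucerRatio_sq hW, saucerTwist, saucerHeight]
  field_simp
  unfold saucerDenom saucerPoly
  ring

/-- The angular momentum that the twist produces is that of the rotated saucer. -/
lemma saucerTwist_mul {W : ℝ} (hW : W ∈ Set.Icc (0 : ℝ) 1) :
    saucerTwist W * (1 - saucerHeight W ^ 2)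
      = W * (1 - W ^ 2) * (1 + 3 * W + W ^ 2) / saucerDenom W := by
  have h1 := (saucerDenom_pos hW).ne'
  have h2 := (saucerPoly_pos hW).ne'
  have h4 := (one_add_cube_pos hW).ne'
  rw [saucerTwist, saucerHeight]
  field_simp
  unfold saucerDenom saucerPoly
  ring

lemma contDiffAt_saucerHeight {W : ℝ} (hW : W ∈ Set.Icc (0 : ℝ) 1) :
    ContDiffAt ℝ ∞ saucerHeight W := by
  have h1 := (saucerDenom_pos hW).ne'
  unfold saucerHeight
  refine ContDiffAt.div (by fun_prop) (by unfold saucerDenom; fun_prop) h1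

lemma deriv_saucerHeight_neg {W : ℝ} (hW : W ∈ Set.Icc (0 : ℝ) 1) : deriv saucerHeight W < 0 := by
  have h1 := saucerDenom_pos hW
  have hn : HasDerivAt (fun W : ℝ => 2 - W ^ 2 - W ^ 3 - W ^ 4)
      (-2 * W - 3 * W ^ 2 - 4 * W ^ 3) W := by
    refine ((((hasDerivAt_const W (2 : ℝ)).sub (hasDerivAt_pow 2 W)).sub
      (hasDerivAt_pow 3 W)).sub (hasDerivAt_pow 4 W)).congr_deriv ?_
    norm_num
  have hd : HasDerivAt saucerDenom (1 - 2 * W - 3 * W ^ 2) W := by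
    refine ((((hasDerivAt_const W (2 : ℝ)).add (hasDerivAt_id W)).sub
      (hasDerivAt_pow 2 W)).sub (hasDerivAt_pow 3 W)).congr_deriv ?_
    simp
  have h := hn.div hd h1.ne'
  rw [show saucerHeight = (fun W : ℝ => 2 - W ^ 2 - W ^ 3 - W ^ 4) / saucerDenom from rfl, h.deriv]
  refine div_neg_of_neg_of_pos ?_ (by positivity)
  have h0 := hW.1
  -- the numerator of the derivative is at most `-2 - W² - 7 W³`
  have e : (-2 * W - 3 * W ^ 2 - 4 * W ^ 3) * saucerDenom W
      - (2 - W ^ 2 - W ^ 3 - W ^ 4) * (1 - 2 * W - 3 * W ^ 2)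
      = -2 - W ^ 2 - 10 * W ^ 3 - 3 * W ^ 4 + 2 * W ^ 5 + W ^ 6 := by
    unfold saucerDenom; ring
  rw [e]
  have e6 : W ^ 6 ≤ W ^ 3 := pow_le_pow_of_le_one h0 hW.2 (by norm_num)
  have e5 : W ^ 5 ≤ W ^ 3 := pow_le_pow_of_le_one h0 hW.2 (by norm_num)
  have : 0 ≤ W ^ 3 := by positivity
  have : 0 ≤ W ^ 4 := by positivity
  nlinarith [sq_nonneg W]

lemma saucerHeight_zero : saucerHeight 0 = 1 := by norm_num [saucerHeight, saucerDenom]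

lemma saucerHeight_one : saucerHeight 1 = -1 := by norm_num [saucerHeight, saucerDenom]

lemma contDiffOn_saucerScale : ContDiffOn ℝ ∞ saucerScale (Set.Icc 0 1) := by
  have hd : ContDiff ℝ ∞ saucerDenom := by unfold saucerDenom; fun_prop
  have hp : ContDiff ℝ ∞ saucerPoly := by unfold saucerPoly; fun_prop
  have hr : ContDiffOn ℝ ∞ saucerRatio (Set.Icc 0 1) := by
    refine ContDiffOn.sqrt (ContDiffOn.div (by fun_prop) (by fun_prop) fun W hW => ?_)
      fun W hW => ?_
    · exact (mul_pos two_pos (saucerDenom_pos hW)).ne'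
    · exact (div_pos (one_add_cube_pos hW) (mul_pos two_pos (saucerDenom_pos hW))).ne'
  exact ContDiffOn.div (by fun_prop) (hp.contDiffOn.mul hr)
    fun W hW => (mul_pos (saucerPoly_pos hW) (saucerRatio_pos hW)).ne'

lemma contDiffOn_saucerTwist : ContDiffOn ℝ ∞ saucerTwist (Set.Icc 0 1) := by
  have hd : ContDiff ℝ ∞ saucerDenom := by unfold saucerDenom; fun_prop
  have hp : ContDiff ℝ ∞ saucerPoly := by unfold saucerPoly; fun_prop
  exact ContDiffOn.div (by fun_prop) (by fun_prop)
    fun W hW => (mul_pos (one_add_cube_pos hW) (saucerPoly_pos hW)).ne'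

/-! ### From the cone surface to the saucer -/

/-- The pairs `(q, p)` of the Lagrangian projection of the standard sphere, described by rotation
invariants; the parameter is the `w` of `standardSphere`. -/
def IsSaucerPoint (q p : E3) : Prop :=
  ∃ w : ℝ, inner ℝ q northPole = -w ^ 2 ∧ inner ℝ p northPole = -w * (1 - w ^ 4) ∧
    inner ℝ p p = w ^ 2 * (1 - w ^ 4)

lemma inner_cross_northPole_self {q : E3} (hq : inner ℝ q q = 1) :
    inner ℝ (cross northPole q) (cross northPole q) = 1 - inner ℝ q northPole ^ 2 := by
  rw [inner_cross_cross_self, hq, inner_northPole_self, real_inner_comm]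
  ring

lemma inner_cross_northPole_right (q p : E3) :
    inner ℝ p (cross northPole q) = inner ℝ northPole (cross q p) := by
  rw [inner_cross_cycle, inner_cross_cycle]

/-- The change of the angular momentum under the fibrewise map `p ↦ m p + g N × q`. -/
lemma inner_cross_add_smul_cross {q : E3} (hq : inner ℝ q q = 1) (p : E3) (m g : ℝ) :
    inner ℝ northPole (cross q (m • p + g • cross northPole q))
      = m * inner ℝ northPole (cross q p) + g * (1 - inner ℝ q northPole ^ 2) := by
  rw [cross_add_right, cross_smul_right, cross_smul_right, inner_add_right, real_inner_smul_right,
    real_inner_smul_right, ← inner_cross_northPole_right q (cross northPole q),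
    inner_cross_northPole_self hq]

lemma inner_self_add_smul_cross {q : E3} (hq : inner ℝ q q = 1) (p : E3) (m g : ℝ) :
    inner ℝ (m • p + g • cross northPole q) (m • p + g • cross northPole q)
      = m ^ 2 * inner ℝ p p + 2 * m * g * inner ℝ northPole (cross q p)
        + g ^ 2 * (1 - inner ℝ q northPole ^ 2) := by
  simp only [inner_add_left, inner_add_right, real_inner_smul_left, real_inner_smul_right,
    inner_cross_northPole_self hq, inner_cross_northPole_right q p,
    real_inner_comm p (cross northPole q)]
  ring

lemma inner_add_smul_cross_northPole (q p : E3) (m g : ℝ) :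
    inner ℝ (m • p + g • cross northPole q) northPole = m * inner ℝ p northPole := by
  rw [inner_add_left, real_inner_smul_left, real_inner_smul_left,
    real_inner_comm northPole (cross northPole q), inner_cross_self_left]
  ring

/-- Three maps carry the cone surface to the saucer: scaling of `p` and addition of a multiple of
`N × q`, rotation of `q` about the axis `p` by the angle `2 arctan |p|`, and subtraction of `N × q`.
The parameter `W` is determined by the height of the first point `q`. -/
lemma isConePoint_iff_isSaucerPoint {q p₀ p₁ q₂ p₂ : E3} (hq : inner ℝ q q = 1)
    (hp : inner ℝ q p₀ = 0) {W : ℝ} (hW : W ∈ Set.Icc (0 : ℝ) 1)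
    (hqW : inner ℝ q northPole = saucerHeight W)
    (hp₁ : p₁ = saucerScale W • p₀ + saucerTwist W • cross northPole q)
    (hq₂ : q₂ = ((1 - inner ℝ p₁ p₁) / (1 + inner ℝ p₁ p₁)) • q
      - (2 / (1 + inner ℝ p₁ p₁)) • cross q p₁)
    (hp₂ : p₂ = p₁ - cross northPole q₂) :
    IsConePoint q p₀ ↔ IsSaucerPoint q₂ p₂ := by
  have hqp₁ : inner ℝ q p₁ = 0 := by
    rw [hp₁, inner_add_right, real_inner_smul_right, real_inner_smul_right, hp,
      inner_cross_self_right]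
    ring
  have hlag₀ := normSq_mul_one_sub_height_sq hq hp
  have hb₁ := inner_add_smul_cross_northPole q p₀ (saucerScale W) (saucerTwist W)
  have he₁ := inner_self_add_smul_cross hq p₀ (saucerScale W) (saucerTwist W)
  have hμ₁ := inner_cross_add_smul_cross hq p₀ (saucerScale W) (saucerTwist W)
  rw [← hp₁] at hb₁ he₁ hμ₁
  have he₁0 : 0 ≤ inner ℝ p₁ p₁ := real_inner_self_nonneg
  -- `C` is the cosine of the angle, and `S * |p₁|` is its sine
  obtain ⟨C, hC⟩ : ∃ C, C = (1 - inner ℝ p₁ p₁) / (1 + inner ℝ p₁ p₁) := ⟨_, rfl⟩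
  obtain ⟨S, hS⟩ : ∃ S, S = 2 / (1 + inner ℝ p₁ p₁) := ⟨_, rfl⟩
  rw [← hC, ← hS] at hq₂
  have hCS : C ^ 2 + S ^ 2 * inner ℝ p₁ p₁ = 1 := by
    rw [hC, hS]; field_simp; ring
  have hcross : cross q₂ p₁ = C • cross q p₁ + (S * inner ℝ p₁ p₁) • q := by
    rw [hq₂, sub_eq_add_neg, ← neg_smul, cross_add_left, cross_smul_left, cross_smul_left,
      cross_cross_self_right, hqp₁]
    module
  have ha₂ : inner ℝ q₂ northPole
      = C * inner ℝ q northPole - S * inner ℝ northPole (cross q p₁) := by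
    rw [hq₂, inner_sub_left, real_inner_smul_left, real_inner_smul_left,
      real_inner_comm northPole (cross q p₁)]
  have hμ₂' : inner ℝ northPole (cross q₂ p₁)
      = C * inner ℝ northPole (cross q p₁) + S * inner ℝ p₁ p₁ * inner ℝ q northPole := by
    rw [hcross, inner_add_right, real_inner_smul_right, real_inner_smul_right,
      real_inner_comm q northPole]
  have hq₂q₂ : inner ℝ q₂ q₂ = 1 := by
    rw [hq₂]
    simp only [inner_sub_left, inner_sub_right, real_inner_smul_left, real_inner_smul_right, hq,
      inner_cross_cross_self, hqp₁, inner_cross_self_left, real_inner_comm q (cross q p₁)]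
    linear_combination hCS
  have hq₂p₁ : inner ℝ q₂ p₁ = 0 := by
    rw [hq₂, inner_sub_left, real_inner_smul_left, real_inner_smul_left, hqp₁,
      real_inner_comm p₁ (cross q p₁), inner_cross_self_right]
    ring
  have hp₂' : p₂ = (1 : ℝ) • p₁ + (-1 : ℝ) • cross northPole q₂ := by rw [hp₂]; module
  have hq₂p₂ : inner ℝ q₂ p₂ = 0 := by
    rw [hp₂, inner_sub_right, hq₂p₁, inner_cross_self_right, sub_zero]
  have hlag₂ := normSq_mul_one_sub_height_sq hq₂q₂ hq₂p₂
  have hb₂ := inner_add_smul_cross_northPole q₂ p₁ 1 (-1)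
  have he₂ := inner_self_add_smul_cross hq₂q₂ p₁ 1 (-1)
  have hμ₂ := inner_cross_add_smul_cross hq₂q₂ p₁ 1 (-1)
  rw [← hp₂'] at hb₂ he₂ hμ₂
  -- the height and the angular momentum before the rotation in terms of those after it
  have ha : inner ℝ q northPole
      = C * inner ℝ q₂ northPole + S * inner ℝ northPole (cross q₂ p₁) := by
    rw [ha₂, hμ₂']
    linear_combination (-inner ℝ q northPole) * hCS
  have hμ₁' : inner ℝ northPole (cross q p₁)
      = C * inner ℝ northPole (cross q₂ p₁) - S * inner ℝ p₁ p₁ * inner ℝ q₂ northPole := by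
    rw [ha₂, hμ₂']
    linear_combination (-inner ℝ northPole (cross q p₁)) * hCS
  have ha₂le : inner ℝ q₂ northPole ^ 2 ≤ 1 := by
    have := real_inner_self_nonneg (x := cross northPole q₂)
    rw [inner_cross_northPole_self hq₂q₂] at this
    linarith
  unfold IsConePoint IsSaucerPoint
  -- from here on only the invariants matter
  generalize inner ℝ q₂ northPole = a₂ at *
  generalize inner ℝ northPole (cross q₂ p₁) = μ₂' at *
  generalize inner ℝ northPole (cross q₂ p₂) = μ₂ at *
  generalize inner ℝ northPole (cross q p₁) = μ₁ at *
  generalize inner ℝ northPole (cross q p₀) = μ₀ at *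
  generalize inner ℝ q northPole = a at *
  generalize inner ℝ p₀ northPole = b₀ at *
  generalize inner ℝ p₁ northPole = b₁ at *
  generalize inner ℝ p₂ northPole = b₂ at *
  generalize inner ℝ p₀ p₀ = e₀ at *
  generalize inner ℝ p₁ p₁ = e₁ at *
  generalize inner ℝ p₂ p₂ = e₂ at *
  clear hp₁ hq₂ hp₂ hp₂' hcross hqp₁ hq₂q₂ hq₂p₁ hq₂p₂ hq hp
  have hD := saucerDenom_pos hW
  have hl := saucerRatio_pos hW
  have hm := saucerScale_pos hW
  have hQ := saucerHeight_eq hW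
  have hsm := saucerScale_mul hW
  have hss := saucerScale_sq_add hW
  have htm := saucerTwist_mul hW
  have hDe : 1 + (1 + W) * (1 - W ^ 2) = saucerDenom W := by unfold saucerDenom; ring
  subst hqW
  constructor
  · rintro ⟨y, hy, h1, h2, h3⟩
    have hyW : y ^ 2 = saucerRatio W ^ 2 * W := by linarith
    have hμ₀ : μ₀ = 0 := by
      rw [h1, h2, h3] at hlag₀
      have : μ₀ ^ 2 = 0 := by linear_combination -hlag₀
      exact pow_eq_zero_iff two_ne_zero |>.1 this
    subst hμ₀
    have he₁' : e₁ = (1 + W) * (1 - W ^ 2) := by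
      rw [he₁, ← hss, h3, hyW]; ring
    have hw : (-(y / saucerRatio W)) ^ 2 = W := by
      rw [neg_sq, div_pow, hyW]; field_simp
    have hw4 : (-(y / saucerRatio W)) ^ 4 = W ^ 2 := by
      rw [pow_mul (-(y / saucerRatio W)) 2 2, hw]
    have hμ₁W : μ₁ = W * (1 - W ^ 2) * (1 + 3 * W + W ^ 2) / saucerDenom W := by
      rw [hμ₁, ← htm]; ring
    have hCW : C = (1 - (1 + W) * (1 - W ^ 2)) / saucerDenom W := by rw [hC, he₁', hDe]
    have hSW : S = 2 / saucerDenom W := by rw [hS, he₁', hDe]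
    have ha₂W : a₂ = -W := by
      rw [ha₂, hCW, hSW, hμ₁W, saucerHeight]
      field_simp
      unfold saucerDenom
      ring
    have hμ₂W : μ₂' = 1 - W ^ 2 := by
      rw [hμ₂', hCW, hSW, hμ₁W, he₁', saucerHeight]
      field_simp
      unfold saucerDenom
      ring
    refine ⟨-(y / saucerRatio W), ?_, ?_, ?_⟩
    · rw [hw, ha₂W]
    · rw [hb₂, hb₁, h2, hw4, ← hsm, hyW]
      field_simp
    · rw [he₂, he₁', hμ₂W, ha₂W, hw, hw4]
      ring
  · rintro ⟨w, h1, h2, h3⟩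
    subst h1
    have hμ₂0 : μ₂ = 0 := by
      rw [h2, h3] at hlag₂
      have : μ₂ ^ 2 = 0 := by linear_combination -hlag₂
      exact pow_eq_zero_iff two_ne_zero |>.1 this
    have hμ₂W : μ₂' = 1 - (w ^ 2) ^ 2 := by linear_combination hμ₂0 - hμ₂
    have he₁' : e₁ = (1 + w ^ 2) * (1 - (w ^ 2) ^ 2) := by
      rw [h3, hμ₂W] at he₂
      linear_combination -he₂
    have hw1 : w ^ 2 ∈ Set.Icc (0 : ℝ) 1 := ⟨sq_nonneg w, by
      rw [neg_sq] at ha₂le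
      exact (sq_le_one_iff₀ (sq_nonneg w)).1 ha₂le⟩
    -- the height before the rotation is `saucerHeight (w ^ 2)`, and `saucerHeight` is injective
    have hwW : w ^ 2 = W := by
      have hinj := (exists_contDiffOn_inverse_Icc zero_le_one
        (fun x hx => contDiffAt_saucerHeight hx) (fun x hx => deriv_saucerHeight_neg hx)).1.injOn
      refine hinj hw1 hW ?_
      have hDw := saucerDenom_pos hw1
      have hDe' : 1 + (1 + w ^ 2) * (1 - (w ^ 2) ^ 2) = saucerDenom (w ^ 2) := by
        unfold saucerDenom; ring
      rw [ha, hC, hS, he₁', hDe', hμ₂W, saucerHeight]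
      field_simp
      ring
    have hw4 : w ^ 4 = W ^ 2 := by rw [← hwW]; ring
    rw [hwW] at he₁' hμ₂W hμ₁'
    have hCW : C = (1 - (1 + W) * (1 - W ^ 2)) / saucerDenom W := by rw [hC, he₁', hDe]
    have hSW : S = 2 / saucerDenom W := by rw [hS, he₁', hDe]
    have hμ₁W : μ₁ = W * (1 - W ^ 2) * (1 + 3 * W + W ^ 2) / saucerDenom W := by
      rw [hμ₁', hCW, hSW, hμ₂W, he₁']
      field_simp
      ring
    have hμ₀ : μ₀ = 0 := by
      have : saucerScale W * μ₀ = 0 := by linear_combination hμ₁W - hμ₁ - htm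
      exact (mul_eq_zero.1 this).resolve_left hm.ne'
    subst hμ₀
    have hy2 : (-(saucerRatio W * w)) ^ 2 = saucerRatio W ^ 2 * W := by rw [← hwW]; ring
    have hR0 : 0 ≤ saucerRatio W ^ 2 * W := mul_nonneg (sq_nonneg _) hW.1
    -- otherwise `saucerScale_mul` has the wrong sign
    have hR1 : saucerRatio W ^ 2 * W ≤ 1 := by
      by_contra! h
      have h5 : saucerScale W * (2 * saucerRatio W * (1 - saucerRatio W ^ 2 * W)) < 0 :=
        mul_neg_of_pos_of_neg hm (mul_neg_of_pos_of_neg (by positivity) (by linarith))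
      rw [hsm] at h5
      exact not_lt.2 (sub_nonneg.2 (pow_le_one₀ hW.1 hW.2)) h5
    refine ⟨-(saucerRatio W * w), ?_, ?_, ?_, ?_⟩
    · have : |(-(saucerRatio W * w))| ≤ 1 := (sq_le_one_iff_abs_le_one _).1 (by rw [hy2]; exact hR1)
      exact abs_le.1 this
    · rw [hy2, hQ]
    · rw [hy2]
      refine mul_left_cancel₀ hm.ne' ?_
      rw [← hb₁]
      rw [hb₂, one_mul, hw4] at h2
      rw [h2, ← hsm]
      ring
    · rw [hy2]
      refine mul_left_cancel₀ (pow_pos hm 2).ne' ?_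
      linear_combination he₁' - he₁ - hss

/-! ### Isotopies of the cotangent bundle -/

/-- `F` is a smooth isotopy of `M` starting at the identity, and `G t` is the inverse of `F t`. The
time runs over the whole line. -/
structure IsSmoothIsotopy {E : Type*} [NormedAddCommGroup E] [NormedSpace ℝ E] {H : Type*}
    [TopologicalSpace H] (I : ModelWithCorners ℝ E H) {M : Type*} [TopologicalSpace M]
    [ChartedSpace H M] (F G : ℝ → M → M) : Prop where
  smooth : ContMDiff (𝓘(ℝ, ℝ).prod I) I ∞ (fun y : ℝ × M => F y.1 y.2)
  smooth_inv : ContMDiff (𝓘(ℝ, ℝ).prod I) I ∞ (fun y : ℝ × M => G y.1 y.2)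
  left_inv : ∀ t x, G t (F t x) = x
  right_inv : ∀ t x, F t (G t x) = x
  zero : ∀ x, F 0 x = x

lemma IsSmoothIsotopy.comp {E : Type*} [NormedAddCommGroup E] [NormedSpace ℝ E] {H : Type*}
    [TopologicalSpace H] {I : ModelWithCorners ℝ E H} {M : Type*} [TopologicalSpace M]
    [ChartedSpace H M] {F G F' G' : ℝ → M → M} (h' : IsSmoothIsotopy I F' G')
    (h : IsSmoothIsotopy I F G) :
    IsSmoothIsotopy I (fun t x => F' t (F t x)) (fun t x => G t (G' t x)) where
  smooth := h'.smooth.comp (contMDiff_fst.prodMk h.smooth)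
  smooth_inv := h.smooth_inv.comp (contMDiff_fst.prodMk h'.smooth_inv)
  left_inv t x := by rw [h'.left_inv, h.left_inv]
  right_inv t x := by rw [h.right_inv, h'.right_inv]
  zero x := by rw [h.zero, h'.zero]

lemma IsSmoothIsotopy.smoothlyAmbientIsotopic {E : Type*} [NormedAddCommGroup E] [NormedSpace ℝ E]
    {H : Type*} [TopologicalSpace H] {I : ModelWithCorners ℝ E H} {M : Type*} [TopologicalSpace M]
    [ChartedSpace H M] {F G : ℝ → M → M} (h : IsSmoothIsotopy I F G) {A B : Set M}
    (hAB : ∀ x, x ∈ A ↔ F 1 x ∈ B) : SmoothlyAmbientIsotopic I A B := by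
  refine ⟨fun t => ⟨⟨F t, G t, h.left_inv t, h.right_inv t⟩,
    h.smooth.comp (contMDiff_const.prodMk contMDiff_id),
    h.smooth_inv.comp (contMDiff_const.prodMk contMDiff_id)⟩, h.smooth.contMDiffOn, h.zero, ?_⟩
  ext y
  constructor
  · rintro ⟨x, hx, rfl⟩
    exact (hAB x).1 hx
  · intro hy
    refine ⟨G 1 y, (hAB _).2 ?_, h.right_inv 1 y⟩
    rwa [h.right_inv]

lemma momentum_cotangentPoint_of_inner_eq_zero {q : S2} {u : E3} (h : inner ℝ (q : E3) u = 0) :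
    momentum (cotangentPoint q u) = u := by
  rw [momentum_cotangentPoint, tangentPart, real_inner_comm, h, zero_smul, sub_zero]

lemma contMDiff_base_coe :
    ContMDiff cotangentModel 𝓘(ℝ, E3) ∞ (fun x : CotangentS2 => (x.1 : E3)) :=
  contMDiff_coe_S2.comp (Bundle.contMDiff_proj _)

/-- The fibrewise affine isotopies of `T*S2`: `p` is scaled by `exp (t l(q))`, and `t β(q)` is
added, where `β` is a tangent vector field. -/
lemma isSmoothIsotopy_affine {l : S2 → ℝ} {β : S2 → E3} (hl : ContMDiff (𝓡 2) 𝓘(ℝ, ℝ) ∞ l)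
    (hβ : ContMDiff (𝓡 2) 𝓘(ℝ, E3) ∞ β) (ho : ∀ q : S2, inner ℝ (q : E3) (β q) = 0) :
    IsSmoothIsotopy cotangentModel
      (fun t x => cotangentPoint x.1 (Real.exp (t * l x.1) • momentum x + t • β x.1))
      (fun t x => cotangentPoint x.1 (Real.exp (-(t * l x.1)) • (momentum x - t • β x.1))) := by
  have h1 : ContMDiff (𝓘(ℝ, ℝ).prod cotangentModel) (𝓡 2) ∞ (fun y : ℝ × CotangentS2 => y.2.1) :=
    (Bundle.contMDiff_proj _).comp contMDiff_snd
  have h2 : ContMDiff (𝓘(ℝ, ℝ).prod cotangentModel) 𝓘(ℝ, E3) ∞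
      (fun y : ℝ × CotangentS2 => momentum y.2) := contMDiff_momentum.comp contMDiff_snd
  have h3 : ContMDiff (𝓘(ℝ, ℝ).prod cotangentModel) 𝓘(ℝ, ℝ) ∞
      (fun y : ℝ × CotangentS2 => y.1) := contMDiff_fst
  have hl' := hl.comp h1
  have hβ' := h3.smul (hβ.comp h1)
  have o1 : ∀ (t : ℝ) (x : CotangentS2),
      inner ℝ (x.1 : E3) (Real.exp (t * l x.1) • momentum x + t • β x.1) = 0 := fun t x => by
    rw [inner_add_right, real_inner_smul_right, real_inner_smul_right, inner_base_momentum, ho]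
    ring
  have o2 : ∀ (t : ℝ) (x : CotangentS2),
      inner ℝ (x.1 : E3) (Real.exp (-(t * l x.1)) • (momentum x - t • β x.1)) = 0 := fun t x => by
    rw [real_inner_smul_right, inner_sub_right, real_inner_smul_right, inner_base_momentum, ho]
    ring
  refine ⟨?_, ?_, fun t x => ?_, fun t x => ?_, fun x => ?_⟩
  · have he : ContMDiff (𝓘(ℝ, ℝ).prod cotangentModel) 𝓘(ℝ, ℝ) ∞
        (fun y : ℝ × CotangentS2 => Real.exp (y.1 * l y.2.1)) :=
      ContDiff.comp_contMDiff_prodMk (g := fun z : ℝ × ℝ => Real.exp (z.1 * z.2)) (by fun_prop)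
        h3 hl'
    exact contMDiff_cotangentPoint h1 ((he.smul h2).add hβ')
  · have he : ContMDiff (𝓘(ℝ, ℝ).prod cotangentModel) 𝓘(ℝ, ℝ) ∞
        (fun y : ℝ × CotangentS2 => Real.exp (-(y.1 * l y.2.1))) :=
      ContDiff.comp_contMDiff_prodMk (g := fun z : ℝ × ℝ => Real.exp (-(z.1 * z.2))) (by fun_prop)
        h3 hl'
    exact contMDiff_cotangentPoint h1 (he.smul (h2.sub hβ'))
  · change cotangentPoint x.1
      (Real.exp (-(t * l x.1)) • (momentum (cotangentPoint x.1 _) - t • β x.1)) = x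
    rw [momentum_cotangentPoint_of_inner_eq_zero (o1 t x), add_sub_cancel_right, smul_smul,
      ← Real.exp_add, neg_add_cancel, Real.exp_zero, one_smul, cotangentPoint_momentum]
  · change cotangentPoint x.1
      (Real.exp (t * l x.1) • (momentum (cotangentPoint x.1 _)) + t • β x.1) = x
    rw [momentum_cotangentPoint_of_inner_eq_zero (o2 t x), smul_smul,
      ← Real.exp_add, add_neg_cancel, Real.exp_zero, one_smul, sub_add_cancel,
      cotangentPoint_momentum]
  · simp [cotangentPoint_momentum]

/-- The result of rotating `q` about the axis `p` by the angle `-2 arctan (t ‖p‖)`, when `q` is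
orthogonal to `p`. The half-angle formulas make it smooth also at `p = 0`. -/
def rotateAbout (t : ℝ) (q p : E3) : E3 :=
  ((1 - t ^ 2 * inner ℝ p p) / (1 + t ^ 2 * inner ℝ p p)) • q
    + (2 * t / (1 + t ^ 2 * inner ℝ p p)) • cross q p

lemma one_add_sq_mul_inner_self_pos (t : ℝ) (p : E3) : 0 < 1 + t ^ 2 * inner ℝ p p := by
  have := real_inner_self_nonneg (x := p)
  positivity

lemma inner_rotateAbout_self {q p : E3} (t : ℝ) (hq : inner ℝ q q = 1) (hp : inner ℝ q p = 0) :
    inner ℝ (rotateAbout t q p) (rotateAbout t q p) = 1 := by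
  have h := (one_add_sq_mul_inner_self_pos t p).ne'
  simp only [rotateAbout, inner_add_left, inner_add_right, real_inner_smul_left,
    real_inner_smul_right, hq, inner_cross_cross_self, hp, inner_cross_self_left,
    real_inner_comm q (cross q p)]
  field_simp
  ring

lemma inner_rotateAbout {q p : E3} (t : ℝ) (hp : inner ℝ q p = 0) :
    inner ℝ (rotateAbout t q p) p = 0 := by
  rw [rotateAbout, inner_add_left, real_inner_smul_left, real_inner_smul_left, hp,
    real_inner_comm p (cross q p), inner_cross_self_right]
  ring

lemma rotateAbout_neg_rotateAbout {q p : E3} (t : ℝ) (hp : inner ℝ q p = 0) :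
    rotateAbout (-t) (rotateAbout t q p) p = q := by
  have h := (one_add_sq_mul_inner_self_pos t p).ne'
  rw [rotateAbout, rotateAbout, cross_add_left, cross_smul_left, cross_smul_left,
    cross_cross_self_right, hp]
  match_scalars
  · field_simp
    ring
  · field_simp
    ring
  · field_simp
    ring

lemma contDiff_rotateAbout :
    ContDiff ℝ ∞ (fun y : ℝ × E3 × E3 => rotateAbout y.1 y.2.1 y.2.2) := by
  have hi : ContDiff ℝ ∞ (fun y : ℝ × E3 × E3 => y.1 ^ 2 * inner ℝ y.2.2 y.2.2) :=
    (contDiff_fst.pow 2).mul (contDiff_snd.snd.inner ℝ contDiff_snd.snd)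
  have hc : ContDiff ℝ ∞ (fun y : ℝ × E3 × E3 => cross y.2.1 y.2.2) :=
    contDiff_cross.comp contDiff_snd
  have hne : ∀ y : ℝ × E3 × E3, 1 + y.1 ^ 2 * inner ℝ y.2.2 y.2.2 ≠ 0 :=
    fun y => (one_add_sq_mul_inner_self_pos y.1 y.2.2).ne'
  exact (((contDiff_const.sub hi).div (contDiff_const.add hi) hne).smul contDiff_snd.fst).add
    (((contDiff_const.mul contDiff_fst).div (contDiff_const.add hi) hne).smul hc)

lemma rotateAbout_mem_sphere (t : ℝ) (x : CotangentS2) :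
    rotateAbout t x.1 (momentum x) ∈ Metric.sphere (0 : E3) 1 := by
  rw [mem_sphere_zero_iff_norm]
  refine (sq_eq_sq₀ (norm_nonneg _) zero_le_one).1 ?_
  rw [← real_inner_self_eq_norm_sq, one_pow,
    inner_rotateAbout_self t (inner_coe_S2_self _) (inner_base_momentum x)]

/-- The map `(q, p) ↦ (rotateAbout t q p, p)` of `T*S2`. It is well defined since `p` stays
orthogonal to the new base point. -/
def axisRotation (t : ℝ) (x : CotangentS2) : CotangentS2 :=
  cotangentPoint ⟨rotateAbout t x.1 (momentum x), rotateAbout_mem_sphere t x⟩ (momentum x)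

lemma momentum_axisRotation (t : ℝ) (x : CotangentS2) :
    momentum (axisRotation t x) = momentum x :=
  momentum_cotangentPoint_of_inner_eq_zero (inner_rotateAbout t (inner_base_momentum x))

lemma axisRotation_neg_axisRotation (t : ℝ) (x : CotangentS2) :
    axisRotation (-t) (axisRotation t x) = x := by
  refine Eq.trans ?_ (cotangentPoint_momentum x)
  rw [axisRotation]
  congr 1
  · ext1
    change rotateAbout (-t) (rotateAbout t x.1 (momentum x)) (momentum (axisRotation t x)) = x.1
    rw [momentum_axisRotation, rotateAbout_neg_rotateAbout t (inner_base_momentum x)]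
  · exact momentum_axisRotation t x

lemma contMDiff_rotateAbout {E : Type*} [NormedAddCommGroup E] [NormedSpace ℝ E] {H : Type*}
    [TopologicalSpace H] {I : ModelWithCorners ℝ E H} {M : Type*} [TopologicalSpace M]
    [ChartedSpace H M] {f : M → ℝ} {q p : M → E3} (hf : ContMDiff I 𝓘(ℝ, ℝ) ∞ f)
    (hq : ContMDiff I 𝓘(ℝ, E3) ∞ q) (hp : ContMDiff I 𝓘(ℝ, E3) ∞ p) :
    ContMDiff I 𝓘(ℝ, E3) ∞ (fun y => rotateAbout (f y) (q y) (p y)) :=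
  contDiff_rotateAbout.comp_contMDiff_prodMk (f' := fun y => (q y, p y)) hf (hq.prodMk_space hp)

lemma contMDiff_axisRotation {E : Type*} [NormedAddCommGroup E] [NormedSpace ℝ E] {H : Type*}
    [TopologicalSpace H] {I : ModelWithCorners ℝ E H} {M : Type*} [TopologicalSpace M]
    [ChartedSpace H M] [IsManifold I ∞ M] {f : M → ℝ} {g : M → CotangentS2}
    (hf : ContMDiff I 𝓘(ℝ, ℝ) ∞ f) (hg : ContMDiff I cotangentModel ∞ g) :
    ContMDiff I cotangentModel ∞ (fun y => axisRotation (f y) (g y)) := by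
  have h1 : ContMDiff I 𝓘(ℝ, E3) ∞ (fun y => ((g y).1 : E3)) := contMDiff_base_coe.comp hg
  have h2 : ContMDiff I 𝓘(ℝ, E3) ∞ (fun y => momentum (g y)) := contMDiff_momentum.comp hg
  exact contMDiff_cotangentPoint (contMDiff_codRestrict_S2 (contMDiff_rotateAbout hf h1 h2)
    fun y => rotateAbout_mem_sphere (f y) (g y)) h2

lemma axisRotation_zero (x : CotangentS2) : axisRotation 0 x = x := by
  refine Eq.trans ?_ (cotangentPoint_momentum x)
  rw [axisRotation]
  congr 1
  ext1
  simp [rotateAbout]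

lemma isSmoothIsotopy_axisRotation :
    IsSmoothIsotopy cotangentModel (fun t => axisRotation (-t)) axisRotation where
  smooth := contMDiff_axisRotation contMDiff_fst.neg contMDiff_snd
  smooth_inv := contMDiff_axisRotation contMDiff_fst contMDiff_snd
  left_inv t x := by simpa using axisRotation_neg_axisRotation (-t) x
  right_inv := axisRotation_neg_axisRotation
  zero x := by rw [neg_zero, axisRotation_zero]

/-! ### The two Lagrangian projections in terms of rotation invariants -/

lemma inner_coe_S2_northPole_mem (q : S2) : inner ℝ (q : E3) northPole ∈ Set.Icc (-1 : ℝ) 1 := by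
  have h := abs_real_inner_le_norm (q : E3) northPole
  rw [norm_northPole, mul_one, norm_eq_of_mem_sphere] at h
  exact abs_le.1 h

/-- A smooth function of the height is smooth on the sphere. -/
lemma contMDiff_comp_height {f : ℝ → ℝ} (hf : ContDiffOn ℝ ∞ f (Set.Icc (-1) 1)) :
    ContMDiff (𝓡 2) 𝓘(ℝ, ℝ) ∞ (fun q : S2 => f (inner ℝ (q : E3) northPole)) := by
  have h : ContMDiff (𝓡 2) 𝓘(ℝ, ℝ) ∞ (fun q : S2 => inner ℝ (q : E3) northPole) :=
    (ContDiff.contMDiff (f := fun u : E3 => inner ℝ u northPole)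
      (contDiff_id.inner ℝ contDiff_const)).comp contMDiff_coe_S2
  exact hf.contMDiffOn.comp_contMDiff h inner_coe_S2_northPole_mem

lemma inner_tangentPart (q : S2) (u : E3) : inner ℝ (q : E3) (tangentPart q u) = 0 := by
  rw [tangentPart, inner_sub_right, real_inner_smul_right, inner_coe_S2_self, real_inner_comm]
  ring

lemma tangentPart_geodesic {v : E3} (hvN : inner ℝ v northPole = 0) (s : ℝ) :
    tangentPart (geodesic v s) northPole = Real.sin s • geodesicVelocity v s := by
  have h := Real.sin_sq_add_cos_sq s
  rw [tangentPart, geodesic, geodesicVelocity, inner_add_right, inner_neg_right,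
    real_inner_smul_right, real_inner_smul_right, inner_northPole_self, real_inner_comm, hvN]
  match_scalars
  · linear_combination -h
  · ring

lemma inner_geodesic_northPole {v : E3} (hvN : inner ℝ v northPole = 0) (s : ℝ) :
    inner ℝ (geodesic v s) northPole = -Real.cos s := by
  simp only [geodesic, inner_add_left, inner_neg_left, real_inner_smul_left, inner_northPole_self,
    hvN]
  ring

lemma inner_geodesic_geodesicVelocity {v : E3} (hv : ‖v‖ = 1) (hvN : inner ℝ v northPole = 0)
    (s : ℝ) : inner ℝ (geodesic v s) (geodesicVelocity v s) = 0 := by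
  have hvv : inner ℝ v v = 1 := by rw [real_inner_self_eq_norm_sq, hv, one_pow]
  have hNv : inner ℝ northPole v = 0 := by rw [real_inner_comm, hvN]
  simp only [geodesic, geodesicVelocity, inner_add_left, inner_add_right, inner_neg_left,
    real_inner_smul_left, real_inner_smul_right, inner_northPole_self, hvN, hNv, hvv]
  ring

/-- The knotted sphere projects to the image of the cone surface under a fibrewise affine map: the
antisymmetric part of `H'` contributes the multiple `O` of the gradient of the height, and the
symmetric part rescales the cone surface by `M`. -/
lemma mem_lagrangianProjection_knottedSphere_iff {H M O : ℝ → ℝ}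
    (hM : ∀ x ∈ Set.Icc (-1 : ℝ) 1, 0 < M x)
    (hH : ∀ s ∈ Set.Icc 0 (2 * Real.pi),
      deriv H s = M (-Real.cos s) * Real.sin (s / 2) + O (-Real.cos s) * Real.sin s)
    (x : CotangentS2) :
    x ∈ lagrangianProjection '' knottedSphere H ↔
      IsConePoint x.1 ((M (inner ℝ (x.1 : E3) northPole))⁻¹ •
        (momentum x - O (inner ℝ (x.1 : E3) northPole) • tangentPart x.1 northPole)) := by
  have hpos := hM _ (inner_coe_S2_northPole_mem x.1)
  rw [isConePoint_iff (inner_coe_S2_self _) (by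
    rw [real_inner_smul_right, inner_sub_right, real_inner_smul_right, inner_base_momentum,
      inner_tangentPart]
    ring)]
  have key : ∀ {v : E3} {s : ℝ}, inner ℝ v northPole = 0 → s ∈ Set.Icc 0 (2 * Real.pi) →
      (x.1 : E3) = geodesic v s →
      ((M (inner ℝ (x.1 : E3) northPole))⁻¹ •
        (momentum x - O (inner ℝ (x.1 : E3) northPole) • tangentPart x.1 northPole)
          = Real.sin (s / 2) • geodesicVelocity v s ↔
        momentum x = deriv H s • geodesicVelocity v s) := by
    intro v s hvN hs hq
    rw [inv_smul_eq_iff₀ hpos.ne', sub_eq_iff_eq_add, hH s hs, hq, tangentPart_geodesic hvN,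
      inner_geodesic_northPole hvN, smul_smul, smul_smul, ← add_smul]
  constructor
  · rintro ⟨_, ⟨v, s, q, hv, hvN, hs, hq, rfl⟩, rfl⟩
    refine ⟨v, s, hv, hvN, hs, hq, (key hvN hs hq).2 ?_⟩
    refine momentum_cotangentPoint_of_inner_eq_zero ?_
    rw [hq, real_inner_smul_right, inner_geodesic_geodesicVelocity hv hvN, mul_zero]
  · rintro ⟨v, s, hv, hvN, hs, hq, hp⟩
    refine ⟨_, ⟨v, s, x.1, hv, hvN, hs, hq, rfl⟩, ?_⟩
    rw [← (key hvN hs hq).1 hp]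
    exact cotangentPoint_momentum x

lemma mem_lagrangianProjection_standardSphere_iff (x : CotangentS2) :
    x ∈ lagrangianProjection '' standardSphere ↔ IsSaucerPoint x.1 (momentum x) := by
  have hqq := inner_coe_S2_self x.1
  have key : ∀ w : ℝ, inner ℝ (x.1 : E3) northPole = -w ^ 2 →
      (momentum x = tangentPart x.1 (-w • northPole) ↔
        inner ℝ (momentum x) northPole = -w * (1 - w ^ 4) ∧
          inner ℝ (momentum x) (momentum x) = w ^ 2 * (1 - w ^ 4)) := by
    intro w hw
    have h0 := inner_base_momentum x
    have h0' : inner ℝ (momentum x) (x.1 : E3) = 0 := by rw [real_inner_comm, h0]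
    have hw' : inner ℝ northPole (x.1 : E3) = -w ^ 2 := by rw [real_inner_comm, hw]
    constructor
    · intro h
      rw [h]
      simp only [tangentPart, inner_sub_left, inner_sub_right, real_inner_smul_left,
        real_inner_smul_right, hqq, hw, hw', inner_northPole_self]
      constructor <;> ring
    · rintro ⟨h1, h2⟩
      have h3 : inner ℝ northPole (momentum x) = -w * (1 - w ^ 4) := by rw [real_inner_comm, h1]
      have : inner ℝ (momentum x - tangentPart x.1 (-w • northPole))
          (momentum x - tangentPart x.1 (-w • northPole)) = 0 := by
        simp only [tangentPart, inner_sub_left, inner_sub_right, real_inner_smul_left,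
          real_inner_smul_right, hqq, hw, hw', inner_northPole_self, h0, h0', h1, h2, h3]
        ring
      exact sub_eq_zero.1 (inner_self_eq_zero.1 this)
  constructor
  · rintro ⟨_, ⟨q, w, hq, rfl⟩, rfl⟩
    exact ⟨w, hq, (key w hq).1 (momentum_cotangentPoint q _)⟩
  · rintro ⟨w, hq, hp⟩
    refine ⟨_, ⟨x.1, w, hq, rfl⟩, ?_⟩
    refine Eq.trans ?_ (cotangentPoint_momentum x)
    rw [(key w hq).2 hp, ← momentum_cotangentPoint]
    exact (cotangentPoint_momentum (cotangentPoint x.1 (-w • northPole))).symm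

end

theorem mainTheorem6 (H : ℝ → ℝ) (hH : IsKnottedProfile H) :
    SmoothlyAmbientIsotopic cotangentModel
      (lagrangianProjection '' knottedSphere H) (lagrangianProjection '' standardSphere) := by
  obtain ⟨M, O, hMs, hOs, hM, hHs⟩ := hH.exists_decomposition
  -- `V` recovers the saucer parameter from the height
  obtain ⟨V, hVs, hVm, -, hV⟩ := (exists_contDiffOn_inverse_Icc zero_le_one
    (fun x hx => contDiffAt_saucerHeight hx) (fun x hx => deriv_saucerHeight_neg hx)).2
  rw [saucerHeight_zero, saucerHeight_one] at hVs hVm hV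
  let a : S2 → ℝ := fun q => inner ℝ (q : E3) northPole
  have ha : ∀ q, a q ∈ Set.Icc (-1 : ℝ) 1 := inner_coe_S2_northPole_mem
  let m : ℝ → ℝ := fun h => saucerScale (V h) / M h
  have hms : ContDiffOn ℝ ∞ m (Set.Icc (-1) 1) :=
    (contDiffOn_saucerScale.comp hVs hVm).div hMs fun h hh => (hM h hh).ne'
  have hmpos : ∀ h ∈ Set.Icc (-1 : ℝ) 1, 0 < m h :=
    fun h hh => div_pos (saucerScale_pos (hVm hh)) (hM h hh)
  -- scaling by `m`, removal of the gradient term, and the twist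
  let l : S2 → ℝ := fun q => Real.log (m (a q))
  let β : S2 → E3 := fun q =>
    -(m (a q) * O (a q)) • tangentPart q northPole + saucerTwist (V (a q)) • cross northPole q
  have hl : ContMDiff (𝓡 2) 𝓘(ℝ, ℝ) ∞ l :=
    contMDiff_comp_height (hms.log fun h hh => (hmpos h hh).ne')
  have hcr : ContMDiff (𝓡 2) 𝓘(ℝ, E3) ∞ (fun q : S2 => cross northPole q) :=
    contDiff_cross.comp_contMDiff_prodMk contMDiff_const contMDiff_coe_S2
  have htp : ContMDiff (𝓡 2) 𝓘(ℝ, E3) ∞ (fun q : S2 => tangentPart q northPole) := by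
    have : ContDiff ℝ ∞ (fun q : E3 => tangentPart q northPole) :=
      contDiff_const.sub ((contDiff_const.inner ℝ contDiff_id).smul contDiff_id)
    exact this.contMDiff.comp contMDiff_coe_S2
  have hβ : ContMDiff (𝓡 2) 𝓘(ℝ, E3) ∞ β :=
    ((contMDiff_comp_height (hms.mul hOs).neg).smul htp).add
      ((contMDiff_comp_height (contDiffOn_saucerTwist.comp hVs hVm)).smul hcr)
  have hβo : ∀ q : S2, inner ℝ (q : E3) (β q) = 0 := fun q => by
    simp only [β, inner_add_right, real_inner_smul_right, inner_tangentPart,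
      inner_cross_self_right]
    ring
  -- the composition of the affine map to the rotated saucer, the rotation of `q` about `p`, and
  -- the translation by `-N × q`
  have iso := (isSmoothIsotopy_affine (l := fun _ => 0) contMDiff_const hcr.neg
    (fun q => by rw [inner_neg_right, inner_cross_self_right, neg_zero])).comp
    (isSmoothIsotopy_axisRotation.comp (isSmoothIsotopy_affine hl hβ hβo))
  refine iso.smoothlyAmbientIsotopic fun x => ?_
  rw [mem_lagrangianProjection_knottedSphere_iff hM hHs,
    mem_lagrangianProjection_standardSphere_iff]
  have hp₁o : inner ℝ (x.1 : E3) (Real.exp (1 * l x.1) • momentum x + (1 : ℝ) • β x.1) = 0 := by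
    rw [inner_add_right, real_inner_smul_right, real_inner_smul_right, inner_base_momentum, hβo]
    ring
  have hp₁ := momentum_cotangentPoint_of_inner_eq_zero hp₁o
  have hMne := (hM _ (ha x.1)).ne'
  refine isConePoint_iff_isSaucerPoint (W := V (a x.1)) (inner_coe_S2_self _) ?_ (hVm (ha x.1))
    (hV (ha x.1)).symm (p₁ := momentum (cotangentPoint x.1 _)) (hp₁.trans ?_) ?_ ?_
  · rw [real_inner_smul_right, inner_sub_right, real_inner_smul_right, inner_base_momentum,
      inner_tangentPart]
    ring
  · rw [one_mul, Real.exp_log (hmpos _ (ha x.1))]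
    simp only [β, m, a]
    match_scalars <;> field_simp
  · change rotateAbout (-1) x.1 _ = _
    rw [rotateAbout, neg_one_sq, one_mul, sub_eq_add_neg _ ((_ : ℝ) • cross _ _), ← neg_smul,
      ← neg_div, mul_neg_one]
  · have ho : ∀ y : CotangentS2, inner ℝ (y.1 : E3)
        (Real.exp (1 * 0) • momentum y + (1 : ℝ) • -cross northPole y.1) = 0 := fun y => by
      rw [inner_add_right, real_inner_smul_right, real_inner_smul_right, inner_base_momentum,
        inner_neg_right, inner_cross_self_right]
      ring
    refine (momentum_cotangentPoint_of_inner_eq_zero (ho _)).trans ?_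
    rw [mul_zero, Real.exp_zero]
    simp only [one_smul]
    rw [← sub_eq_add_neg, momentum_axisRotation]
    rfl
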